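/- Let $N\ge 1$, let $\lambda_1,\dots,\lambda_N>0$, and let $G_1,\dots,G_N$ be probability distributions on $[0,\infty)$ with finite means $x_1,\dots,x_N$. Consider the multi-class M/G/1/1 system: for each $n$, class-$n$ packets are generated and arrive at a single server at the points $T_{n,1}<T_{n,2}<\cdots$ of a Poisson process on $(0,\infty)$ of rate $\lambda_n$, and the $i$-th class-$n$ packet requires a service time $S_{n,i}$ with distribution $G_n$; the $N$ Poisson processes and all service times are mutually independent. The server is idle at time $0$ and there is no buffer: a packet that finds the server idle on arrival is admitted, enters service at once and is received when its service is completed; a packet that finds the server busy is discarded. The status age $\Delta_n(t)$ of class $n$ is $t$ minus the generation time of the latest class-$n$ packet received up to time $t$ (before the first reception, $\Delta_n(t)=a_n+t$ with a given initial age $a_n\ge 0$). Let $A_{nk}$ be the $k$-th peak of $\Delta_n$, that is, the value of $\Delta_n$ immediately before the $k$-th reception of a class-$n$ packet. Then, almost surely, the set of admitted packets is uniquely determined, and for every class $n$ infinitely many class-$n$ packets are received and the peak age-of-information of class $n$ exists and equals $$A_{p,n}=\lim_{K\to\infty}\frac1K\sum_{k=1}^K A_{nk}=x_n+\frac1{\lambda_n}+\frac{\sum_{k=1}^N\lambda_k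 x_k}{\lambda_n}.$$ No stability condition (such as $\sum_k\lambda_kx_k<1$) and no finiteness of second moments is assumed. -/

import Mathlib

open MeasureTheory ProbabilityTheory Filter Topology

/-! One realization of a multi-class loss system with a single server and no buffer.
Packets are labelled by pairs `(n, i)`: the `i`-th packet (`i = 0, 1, …`) of class `n : Fin N`.
`T n i` is its generation (arrival) time and `S n i` is the service time it requires. -/

namespace MG11

noncomputable section

/-- The arrival times of a renewal stream with inter-arrival times `τ 0, τ 1, …`, started at time
`0`. If the `τ i` are i.i.d. exponential of rate `r`, this is the Poisson process of rate `r`. -/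
def arrivalTime (τ : ℕ → ℝ) (i : ℕ) : ℝ := ∑ j ∈ Finset.range (i + 1), τ j

/-- `Adm` is the set of admitted packets: a packet is admitted if and only if it does not find the
server busy on arrival, i.e. every previously admitted packet has already left. All other packets
are discarded. The server is idle at time `0`. -/
def IsAdmitted {N : ℕ} (T S : Fin N → ℕ → ℝ) (Adm : Set (Fin N × ℕ)) : Prop :=
  ∀ p : Fin N × ℕ, p ∈ Adm ↔
    ∀ q ∈ Adm, T q.1 q.2 < T p.1 p.2 → T q.1 q.2 + S q.1 q.2 ≤ T p.1 p.2

/-- The generation time of the latest class-`n` packet received (i.e. completely served) up to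
time `t`. The information held about class `n` at time `0` has age `a₀`. -/
def lastGeneration {N : ℕ} (T S : Fin N → ℕ → ℝ) (Adm : Set (Fin N × ℕ)) (a₀ : ℝ)
    (n : Fin N) (t : ℝ) : ℝ :=
  sSup (insert (-a₀) {u | ∃ i, (n, i) ∈ Adm ∧ T n i + S n i ≤ t ∧ u = T n i})

/-- The status age `Δ_n(t)`: the time elapsed since the latest received class-`n` packet was
generated. -/
def age {N : ℕ} (T S : Fin N → ℕ → ℝ) (Adm : Set (Fin N × ℕ)) (a₀ : ℝ)
    (n : Fin N) (t : ℝ) : ℝ :=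
  t - lastGeneration T S Adm a₀ n t

/-- The time at which the `k`-th (`k = 0, 1, …`) admitted class-`n` packet completes service.
(Admitted packets are served in the order of their arrival.) -/
def receptionTime {N : ℕ} (T S : Fin N → ℕ → ℝ) (Adm : Set (Fin N × ℕ))
    (n : Fin N) (k : ℕ) : ℝ :=
  T n (Nat.nth (fun i => (n, i) ∈ Adm) k) + S n (Nat.nth (fun i => (n, i) ∈ Adm) k)

/-- The `k`-th peak of the status age of class `n`: the value of `Δ_n` just before it drops at the
`k`-th reception of a class-`n` packet. -/
def peakAge {N : ℕ} (T S : Fin N → ℕ → ℝ) (Adm : Set (Fin N × ℕ)) (a₀ : ℝ)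
    (n : Fin N) (k : ℕ) : ℝ :=
  Function.leftLim (age T S Adm a₀ n) (receptionTime T S Adm n k)

/-- `a` is the peak age-of-information of class `n`: there are infinitely many receptions (hence
peaks) of class `n`, and the long-run average of the peaks exists and equals `a`. -/
def HasPAoI {N : ℕ} (T S : Fin N → ℕ → ℝ) (Adm : Set (Fin N × ℕ)) (a₀ : ℝ)
    (n : Fin N) (a : ℝ) : Prop :=
  {i : ℕ | (n, i) ∈ Adm}.Infinite ∧
    Tendsto (fun K : ℕ => (1 / (K : ℝ)) * ∑ k ∈ Finset.range K, peakAge T S Adm a₀ n k)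
      atTop (𝓝 a)

end

end MG11

/-! By memorylessness of the exponential law, each departure is a regeneration time of the marked
Poisson input: seen from there, the future input is independent of the past and has the original
law. The admitted packets are therefore i.i.d., each preceded by an idle period of law
`Exp (∑ λ_k)`, of class `n` with probability `λ_n / ∑ λ_k` and then with service law `G_n`. The sum
of the peaks of class `n` telescopes: it is the time of the last reception plus the sum of the
earlier class-`n` service times, up to the initial age. Dividing by the number of class-`n`
receptions and applying the strong law of large numbers to the three sequences gives the limit
`((1 + ∑ λ_k x_k) / ∑ λ_k + λ_n x_n / ∑ λ_k) / (λ_n / ∑ λ_k)`. -/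

namespace MG11

noncomputable section

open scoped ENNReal Function

section Averages

lemma tendsto_succ_div_iff {u : ℕ → ℝ} {r : ℝ} :
    Tendsto (fun n => u (n + 1) / n) atTop (𝓝 r) ↔ Tendsto (fun n => u n / n) atTop (𝓝 r) := by
  have hratio : Tendsto (fun n : ℕ => ((n : ℝ) + 1) / n) atTop (𝓝 1) := by
    simpa only [inv_div, inv_one] using (tendsto_natCast_div_add_atTop (1 : ℝ)).inv₀ one_ne_zero
  rw [← tendsto_add_atTop_iff_nat (f := fun n => u n / n) 1]
  constructor <;> intro h
  · refine (mul_one r ▸ h.mul (tendsto_natCast_div_add_atTop (1 : ℝ))).congr' ?_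
    filter_upwards [eventually_ne_atTop 0] with n hn
    push_cast
    field_simp
  · refine (mul_one r ▸ h.mul hratio).congr' ?_
    filter_upwards [eventually_ne_atTop 0] with n hn
    push_cast
    field_simp

variable {P : ℕ → Prop} [DecidablePred P]

lemma sum_range_nth_ite (hP : {m | P m}.Infinite) (f : ℕ → ℝ) (K : ℕ) :
    (∑ l ∈ Finset.range (Nat.nth P K), if P l then f l else 0) =
      ∑ k ∈ Finset.range K, f (Nat.nth P k) := by
  rw [← Finset.sum_filter]
  induction K with
  | zero =>
    refine Finset.sum_eq_zero fun l hl => ?_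
    rw [Finset.mem_filter, Finset.mem_range] at hl
    exact absurd (Nat.nth_zero_of_exists ⟨l, hl.2⟩ ▸ Nat.find_min' _ hl.2) hl.1.not_ge
  | succ K ih =>
    rw [Nat.filter_range_nth_eq_insert_of_infinite hP, Finset.sum_insert (by simp), ih,
      Finset.sum_range_succ, add_comm]

lemma infinite_of_tendsto_count_div {c : ℝ} (hc : c ≠ 0)
    (h : Tendsto (fun m : ℕ => (Nat.count P m : ℝ) / m) atTop (𝓝 c)) : {m | P m}.Infinite := by
  intro hfin
  have hbdd : ∀ m, (Nat.count P m : ℝ) ≤ hfin.toFinset.card := fun m => by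
    rw [Nat.count_eq_card_filter_range]
    exact_mod_cast Finset.card_le_card fun l hl => hfin.mem_toFinset.2 (Finset.mem_filter.1 hl).2
  refine hc (tendsto_nhds_unique h (squeeze_zero (fun m => by positivity)
    (fun m => div_le_div_of_nonneg_right (hbdd m) m.cast_nonneg) ?_))
  exact tendsto_const_div_atTop_nhds_zero_nat _

lemma tendsto_comp_nth_div {f : ℕ → ℝ} {r c : ℝ} (hc : c ≠ 0)
    (hcount : Tendsto (fun m : ℕ => (Nat.count P m : ℝ) / m) atTop (𝓝 c))
    (hf : Tendsto (fun m : ℕ => f m / m) atTop (𝓝 r)) :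
    Tendsto (fun K : ℕ => f (Nat.nth P K) / K) atTop (𝓝 (r / c)) := by
  have hP := infinite_of_tendsto_count_div hc hcount
  have hnth : Tendsto (Nat.nth P) atTop atTop := (Nat.nth_strictMono hP).tendsto_atTop
  refine ((hf.comp hnth).div (hcount.comp hnth) hc).congr' ?_
  filter_upwards [hnth.eventually_ne_atTop 0] with K hK
  rw [Pi.div_apply, Function.comp_apply, Function.comp_apply, Nat.count_nth_of_infinite hP]
  exact div_div_div_cancel_right₀ (Nat.cast_ne_zero.2 hK) _ _

end Averages

section Birkhoff

variable {X E : Type*} [MeasurableSpace X] {μ : Measure X} {T : X → X}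

lemma indepFun_comp_measurePreserving {Y F F' : Type*} [MeasurableSpace Y] [MeasurableSpace F]
    [MeasurableSpace F'] {ν : Measure Y} {f : Y → F} {g : Y → F'} {S : X → Y}
    (hind : IndepFun f g ν) (hS : MeasurePreserving S μ ν) (hf : Measurable f)
    (hg : Measurable g) : IndepFun (f ∘ S) (g ∘ S) μ := by
  rw [indepFun_iff_measure_inter_preimage_eq_mul] at hind ⊢
  intro s t hs ht
  simp only [Set.preimage_comp, ← Set.preimage_inter]
  rw [hS.measure_preimage ((hf hs).inter (hg ht)).nullMeasurableSet,
    hS.measure_preimage (hf hs).nullMeasurableSet, hS.measure_preimage (hg ht).nullMeasurableSet,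
    hind s t hs ht]

lemma ae_tendsto_birkhoffAverage [NormedAddCommGroup E] [NormedSpace ℝ E] [CompleteSpace E]
    [MeasurableSpace E] [BorelSpace E] {g : X → E} (hT : MeasurePreserving T μ μ)
    (hg : Measurable g) (hint : Integrable g μ) (hind : IndepFun g T μ) :
    ∀ᵐ x ∂μ, Tendsto (birkhoffAverage ℝ T g · x) atTop (𝓝 (∫ x, g x ∂μ)) := by
  have hlt : ∀ i j, i < j → IndepFun (g ∘ T^[i]) (g ∘ T^[j]) μ := by
    intro i j hij
    obtain ⟨k, rfl⟩ := Nat.exists_eq_add_of_lt hij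
    have hshift : IndepFun g (g ∘ T^[k + 1]) μ := by
      rw [Function.iterate_succ, ← Function.comp_assoc]
      exact hind.comp measurable_id (hg.comp (hT.measurable.iterate k))
    have hcomp := indepFun_comp_measurePreserving hshift (hT.iterate i) hg
      (hg.comp (hT.measurable.iterate _))
    rwa [Function.comp_assoc, ← Function.iterate_add, show k + 1 + i = i + k + 1 by omega]
      at hcomp
  refine strong_law_ae (fun i => g ∘ T^[i]) hint (fun i j hij => ?_) fun i => ?_
  · exact hij.lt_or_gt.elim (hlt i j) fun h => (hlt j i h).symm
  · refine ⟨(hg.comp (hT.measurable.iterate i)).aemeasurable, hg.aemeasurable, ?_⟩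
    rw [← Measure.map_map hg (hT.measurable.iterate i), (hT.iterate i).map_eq]
    rfl

end Birkhoff

section ExpMeasure

lemma measurable_exponentialPDF (r : ℝ) : Measurable (exponentialPDF r) :=
  (measurable_exponentialPDFReal r).ennreal_ofReal

instance nullSingletonClass_expMeasure (r : ℝ) : NullSingletonClass (expMeasure r) := by
  unfold expMeasure gammaMeasure
  infer_instance

variable {r : ℝ}

lemma expMeasure_Ioi (hr : 0 < r) (s : ℝ) :
    expMeasure r (Set.Ioi s) = ENNReal.ofReal (Real.exp (-(r * max s 0))) := by
  have := isProbabilityMeasure_expMeasure hr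
  rw [← Set.compl_Iic, prob_compl_eq_one_sub measurableSet_Iic, ← ofReal_cdf,
    cdf_expMeasure_eq hr, ← ENNReal.ofReal_one]
  split_ifs with hs
  · rw [← ENNReal.ofReal_sub _ (by simpa using mul_nonneg hr.le hs), sub_sub_cancel,
      max_eq_left hs]
  · simp [(not_le.1 hs).le]

lemma ae_pos_expMeasure (hr : 0 < r) : ∀ᵐ a ∂expMeasure r, 0 < a := by
  have := isProbabilityMeasure_expMeasure hr
  refine (prob_compl_eq_zero_iff measurableSet_Ioi).2 ?_
  simp [expMeasure_Ioi hr]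

lemma map_sub_restrict_Ioi_expMeasure (hr : 0 < r) {t : ℝ} (ht : 0 ≤ t) :
    ((expMeasure r).restrict (Set.Ioi t)).map (· - t) =
      ENNReal.ofReal (Real.exp (-(r * t))) • expMeasure r := by
  have := isProbabilityMeasure_expMeasure hr
  have hmeas : Measurable (· - t) := measurable_id.sub_const t
  refine ext_of_generate_finite _ (borel_eq_generateFrom_Ioi ℝ ▸ BorelSpace.measurable_eq)
    isPiSystem_Ioi ?_ ?_
  · rintro _ ⟨s, rfl⟩
    have hpre : (· - t) ⁻¹' Set.Ioi s ∩ Set.Ioi t = Set.Ioi (max s 0 + t) := by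
      ext a
      rw [max_add, zero_add, Set.mem_Ioi, max_lt_iff, ← lt_sub_iff_add_lt]
      rfl
    rw [Measure.map_apply hmeas measurableSet_Ioi,
      Measure.restrict_apply (hmeas measurableSet_Ioi), hpre, expMeasure_Ioi hr,
      Measure.smul_apply, expMeasure_Ioi hr, smul_eq_mul, ← ENNReal.ofReal_mul (Real.exp_pos _).le,
      ← Real.exp_add, max_eq_left (by positivity)]
    ring_nf
  · rw [Measure.map_apply hmeas MeasurableSet.univ, Set.preimage_univ, Measure.restrict_apply_univ,
      expMeasure_Ioi hr, max_eq_left ht, Measure.smul_apply, measure_univ, smul_eq_mul, mul_one]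

lemma withDensity_exp_expMeasure {θ : ℝ} (hr : 0 < r) (hθ : 0 ≤ θ) :
    (expMeasure r).withDensity (fun a => ENNReal.ofReal (Real.exp (-(θ * a)))) =
      ENNReal.ofReal (r / (r + θ)) • expMeasure (r + θ) := by
  change (volume.withDensity (exponentialPDF r)).withDensity _ =
    _ • volume.withDensity (exponentialPDF (r + θ))
  rw [← withDensity_mul _ (measurable_exponentialPDF r) (by fun_prop),
    ← withDensity_smul _ (measurable_exponentialPDF _)]
  congr 1
  funext a
  rw [Pi.mul_apply, Pi.smul_apply, smul_eq_mul]
  rcases lt_or_ge a 0 with ha | ha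
  · simp [exponentialPDF_of_neg ha]
  · rw [exponentialPDF_of_nonneg ha, exponentialPDF_of_nonneg ha,
      ← ENNReal.ofReal_mul (by positivity), ← ENNReal.ofReal_mul (by positivity), mul_assoc,
      ← Real.exp_add, ← mul_assoc, div_mul_cancel₀ _ (by positivity : r + θ ≠ 0)]
    ring_nf

lemma lintegral_ofReal_expMeasure (hr : 0 < r) :
    ∫⁻ a, ENNReal.ofReal a ∂expMeasure r = ENNReal.ofReal (1 / r) := by
  have hpos := (ae_pos_expMeasure hr).mono fun a ha => ha.le
  have hneg : -r < 0 := neg_lt_zero.2 hr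
  calc ∫⁻ a, ENNReal.ofReal a ∂expMeasure r
      = ∫⁻ t in Set.Ioi 0, expMeasure r (Set.Ioi t) :=
        lintegral_eq_lintegral_meas_lt _ hpos aemeasurable_id
    _ = ∫⁻ t in Set.Ioi 0, ENNReal.ofReal (Real.exp (-r * t)) := by
        refine setLIntegral_congr_fun measurableSet_Ioi fun t ht => ?_
        rw [expMeasure_Ioi hr, max_eq_left (Set.mem_Ioi.1 ht).le, neg_mul]
    _ = ENNReal.ofReal (1 / r) := by
        rw [← ofReal_integral_eq_lintegral_ofReal (integrableOn_exp_mul_Ioi hneg 0)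
          (ae_of_all _ fun t => (Real.exp_pos _).le), integral_exp_mul_Ioi hneg]
        simp

lemma integrable_id_expMeasure (hr : 0 < r) : Integrable (fun a : ℝ => a) (expMeasure r) := by
  refine ⟨measurable_id.aestronglyMeasurable, ?_⟩
  rw [hasFiniteIntegral_iff_ofReal ((ae_pos_expMeasure hr).mono fun a ha => ha.le),
    lintegral_ofReal_expMeasure hr]
  exact ENNReal.ofReal_lt_top

lemma integral_id_expMeasure (hr : 0 < r) : ∫ a, a ∂expMeasure r = 1 / r := by
  rw [integral_eq_lintegral_of_nonneg_ae ((ae_pos_expMeasure hr).mono fun a ha => ha.le)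
    measurable_id.aestronglyMeasurable, lintegral_ofReal_expMeasure hr,
    ENNReal.toReal_ofReal (by positivity)]

end ExpMeasure

section Pi

variable {ι : Type*} [Fintype ι] [DecidableEq ι] {X : ι → Type*} [∀ i, MeasurableSpace (X i)]

lemma measurePreserving_eval_prod_restrict_ne (μ : ∀ i, Measure (X i)) [∀ i, SigmaFinite (μ i)]
    (i : ι) :
    MeasurePreserving (fun (x : ∀ i, X i) => (x i, fun k : {k // ¬k = i} => x k)) (Measure.pi μ)
      ((μ i).prod (Measure.pi fun k : {k // ¬k = i} => μ k)) := by
  have hsplit := measurePreserving_piEquivPiSubtypeProd μ (· = i)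
  let : Fintype {k // k = i} := Subtype.fintype (· = i)
  have hunique := measurePreserving_piUnique fun k : {k // k = i} => μ k
  exact (hunique.prod (MeasurePreserving.id _)).comp hsplit

lemma pi_setOf_forall_ne_mem (μ : ∀ i, Measure (X i)) [∀ i, SigmaFinite (μ i)] (i : ι)
    {C : Set (X i)} (hC : MeasurableSet C) {D : ∀ k, Set (X i × X k)}
    (hD : ∀ k, MeasurableSet (D k)) :
    Measure.pi μ {x | x i ∈ C ∧ ∀ k ≠ i, (x i, x k) ∈ D k} =
      ∫⁻ a in C, ∏ k ∈ Finset.univ.erase i, μ k (Prod.mk a ⁻¹' D k) ∂μ i := by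
  set V : Set (X i × ∀ k : {k // ¬k = i}, X k) :=
    {z | z.1 ∈ C ∧ ∀ k : {k // ¬k = i}, (z.1, z.2 k) ∈ D k} with hV
  have hVm : MeasurableSet V := by
    simp only [hV, Set.ofPred_and, Set.ofPred_forall]
    exact (measurable_fst hC).inter <| MeasurableSet.iInter fun k =>
      (measurable_fst.prodMk ((measurable_pi_apply k).comp measurable_snd)) (hD k)
  have hpre : {x | x i ∈ C ∧ ∀ k ≠ i, (x i, x k) ∈ D k} =
      (fun (x : ∀ i, X i) => (x i, fun k : {k // ¬k = i} => x k)) ⁻¹' V := by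
    ext x
    simp [hV]
  rw [hpre, (measurePreserving_eval_prod_restrict_ne μ i).measure_preimage hVm.nullMeasurableSet,
    Measure.prod_apply hVm, ← lintegral_indicator hC]
  refine lintegral_congr fun a => ?_
  by_cases ha : a ∈ C
  · have hfiber : Prod.mk a ⁻¹' V = Set.univ.pi fun k : {k // ¬k = i} => Prod.mk a ⁻¹' D k := by
      ext y
      simp [hV, ha]
    rw [Set.indicator_of_mem ha, hfiber, Measure.pi_pi]
    exact (Finset.prod_subtype _ (fun k => by simp) fun k => μ k (Prod.mk a ⁻¹' D k)).symm
  · simp [hV, ha]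

end Pi

lemma ae_pi_eval_ne {ι α : Type*} [Fintype ι] {X : ι → Type*} [∀ i, MeasurableSpace (X i)]
    [MeasurableSpace α] [MeasurableEq α] {μ : ∀ i, Measure (X i)} [∀ i, IsProbabilityMeasure (μ i)]
    {n k : ι} (hnk : n ≠ k) {f : X n → α} {g : X k → α} (hf : Measurable f) (hg : Measurable g)
    (h : ∀ c, ∀ᵐ x ∂μ n, f x ≠ c) : ∀ᵐ x ∂Measure.pi μ, f (x n) ≠ g (x k) := by
  classical
  have hmeas : MeasurableSet
      {p : X k × ((i : {i // ¬i = k}) → X i) | f (p.2 ⟨n, hnk⟩) ≠ g p.1} :=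
    (measurableSet_eq_fun (by fun_prop) (by fun_prop)).compl
  exact (measurePreserving_eval_prod_restrict_ne μ k).quasiMeasurePreserving.ae
    ((Measure.ae_prod_iff_ae_ae hmeas).2 <| ae_of_all _ fun z =>
      (Measure.quasiMeasurePreserving_eval (μ := fun i : {i // ¬i = k} => μ i) ⟨n, hnk⟩).ae
        (h (g z)))

section IID

variable {X : Type*}

/-- The sequence with first term `z` and remaining terms `w`. -/
def prepend (z : X) (w : ℕ → X) : ℕ → X
  | 0 => z
  | i + 1 => w i

variable [MeasurableSpace X]

lemma measurable_prepend : Measurable fun p : X × (ℕ → X) => prepend p.1 p.2 :=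
  measurable_pi_lambda _ fun i => by
    cases i with
    | zero => exact measurable_fst
    | succ i => exact (measurable_pi_apply i).comp measurable_snd

lemma eq_infinitePi_of_forall_range {Y : ℕ → Type*} [∀ i, MeasurableSpace (Y i)]
    {μ : ∀ i, Measure (Y i)} [∀ i, IsProbabilityMeasure (μ i)] {ν : Measure (∀ i, Y i)}
    (hν : ∀ (n : ℕ) (t : ∀ i, Set (Y i)), (∀ i, MeasurableSet (t i)) →
      ν (Set.pi (Finset.range n) t) = ∏ i ∈ Finset.range n, μ i (t i)) :
    ν = Measure.infinitePi μ := by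
  classical
  refine Measure.eq_infinitePi _ fun s t ht => ?_
  obtain ⟨n, hn⟩ := s.exists_nat_subset_range
  have hpi : Set.pi (s : Set ℕ) t =
      Set.pi (Finset.range n : Set ℕ) fun i => if i ∈ s then t i else Set.univ := by
    ext w
    refine ⟨fun h i _ => ?_, fun h i hi => by simpa [Finset.mem_coe.1 hi] using h i (hn hi)⟩
    change w i ∈ if i ∈ s then t i else Set.univ
    split_ifs with hi
    exacts [h i hi, Set.mem_univ _]
  rw [hpi, hν n _ fun i => by split_ifs; exacts [ht i, MeasurableSet.univ],
    ← Finset.prod_subset hn fun i _ hi => by simp [hi]]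
  exact Finset.prod_congr rfl fun i hi => by simp [hi]

/-- The law of a sequence of independent random variables with common law `ρ`. -/
def iidLaw (ρ : Measure X) : Measure (ℕ → X) := Measure.infinitePi fun _ => ρ

variable (ρ : Measure X) [IsProbabilityMeasure ρ]

instance isProbabilityMeasure_iidLaw : IsProbabilityMeasure (iidLaw ρ) := by
  unfold iidLaw
  infer_instance

lemma measurePreserving_eval_iidLaw (i : ℕ) :
    MeasurePreserving (fun w => w i) (iidLaw ρ) ρ :=
  measurePreserving_eval_infinitePi (fun _ => ρ) i

lemma measurePreserving_prepend :
    MeasurePreserving (fun p : X × (ℕ → X) => prepend p.1 p.2) (ρ.prod (iidLaw ρ)) (iidLaw ρ) := by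
  refine ⟨measurable_prepend, eq_infinitePi_of_forall_range fun n t ht => ?_⟩
  have hmeas : MeasurableSet (Set.pi (Finset.range n : Set ℕ) t) :=
    MeasurableSet.pi (Finset.countable_toSet _) fun i _ => ht i
  rw [Measure.map_apply measurable_prepend hmeas]
  cases n with
  | zero => simp
  | succ n =>
    have hpre : (fun p : X × (ℕ → X) => prepend p.1 p.2) ⁻¹'
        Set.pi (Finset.range (n + 1) : Set ℕ) t =
        t 0 ×ˢ Set.pi (Finset.range n : Set ℕ) fun i => t (i + 1) := by
      ext ⟨z, w⟩
      simp only [Set.mem_preimage, Set.mem_pi, Finset.mem_coe, Finset.mem_range, Set.mem_prod,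
        Nat.forall_lt_succ_left]
      rfl
    rw [hpre, Measure.prod_prod, iidLaw, Measure.infinitePi_pi _ fun i _ => ht _,
      Finset.prod_range_succ', mul_comm]

variable {ρ}

lemma iidLaw_apply {B : Set (ℕ → X)} (hB : MeasurableSet B) :
    iidLaw ρ B = ∫⁻ z, iidLaw ρ {w | prepend z w ∈ B} ∂ρ := by
  rw [← (measurePreserving_prepend ρ).measure_preimage hB.nullMeasurableSet,
    Measure.prod_apply (measurable_prepend hB)]
  rfl

lemma ae_iidLaw_forall {p : X → Prop} (hp : ∀ᵐ z ∂ρ, p z) : ∀ᵐ w ∂iidLaw ρ, ∀ i, p (w i) :=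
  ae_all_iff.2 fun i => (measurePreserving_eval_iidLaw ρ i).quasiMeasurePreserving.ae hp

lemma ae_iidLaw_of_prepend {p : (ℕ → X) → Prop} (hp : MeasurableSet {w | p w})
    (h : ∀ᵐ z ∂ρ, ∀ᵐ w ∂iidLaw ρ, p (prepend z w)) : ∀ᵐ w ∂iidLaw ρ, p w := by
  rw [← (measurePreserving_prepend ρ).map_eq, ae_map_iff measurable_prepend.aemeasurable hp]
  exact (Measure.ae_prod_iff_ae_ae (measurable_prepend hp)).2 h

end IID

/-- The packets of one class in order of arrival, each with its interarrival time (measured from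
the previous arrival, or from the origin of time for the first packet) and a mark. -/
abbrev MarkedStream (E : Type*) := ℕ → ℝ × E

namespace MarkedStream

variable {E : Type*}

/-- The arrival time of the `i`-th packet of the stream. -/
def arrival (w : MarkedStream E) (i : ℕ) : ℝ := arrivalTime (fun j => (w j).1) i

/-- The index of the first packet arriving after time `r` (junk value `0` if there is none). -/
def firstAfter (r : ℝ) (w : MarkedStream E) : ℕ := sInf {i | r < w.arrival i}

/-- The stream as seen from time `r` on: packets that arrived up to time `r` are dropped, and `r`
becomes the origin of time. -/
def shift (r : ℝ) (w : MarkedStream E) : MarkedStream E := fun i =>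
  (if i = 0 then w.arrival (firstAfter r w) - r else (w (firstAfter r w + i)).1,
    (w (firstAfter r w + i)).2)

/-- The arrival times of the stream are unbounded. -/
def Unbounded (w : MarkedStream E) : Prop := ∀ r, ∃ i, r < w.arrival i

section Path

variable {w : MarkedStream E} {r : ℝ}

lemma arrival_zero (w : MarkedStream E) : w.arrival 0 = (w 0).1 := by
  simp [arrival, arrivalTime]

lemma arrival_succ (w : MarkedStream E) (i : ℕ) :
    w.arrival (i + 1) = w.arrival i + (w (i + 1)).1 :=
  Finset.sum_range_succ _ _

lemma strictMono_arrival (hw : ∀ i, 0 < (w i).1) : StrictMono w.arrival :=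
  strictMono_nat_of_lt_succ fun i => by rw [arrival_succ]; linarith [hw (i + 1)]

lemma arrival_prepend_zero (z : ℝ × E) (w : MarkedStream E) :
    arrival (prepend z w) 0 = z.1 := arrival_zero _

lemma arrival_prepend_succ (z : ℝ × E) (w : MarkedStream E) (i : ℕ) :
    arrival (prepend z w) (i + 1) = z.1 + w.arrival i := by
  induction i with
  | zero => rw [arrival_succ, arrival_prepend_zero, arrival_zero]; rfl
  | succ i ih => rw [arrival_succ, ih, arrival_succ, add_assoc]; rfl

lemma firstAfter_eq_of {j : ℕ} (hj : r < w.arrival j) (hlt : ∀ i < j, w.arrival i ≤ r) :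
    firstAfter r w = j :=
  le_antisymm (Nat.sInf_le hj) (le_csInf ⟨j, hj⟩ fun _ hi =>
    not_lt.1 fun h => (hlt _ h).not_gt hi)

lemma Unbounded.lt_arrival_firstAfter (hw : w.Unbounded) (r : ℝ) :
    r < w.arrival (firstAfter r w) := Nat.sInf_mem (hw r)

lemma Unbounded.firstAfter_eq_zero_iff (hw : w.Unbounded) :
    firstAfter r w = 0 ↔ r < (w 0).1 := by
  refine ⟨fun h => ?_, fun h => firstAfter_eq_of ((arrival_zero w).symm ▸ h) (by simp)⟩
  simpa [h, arrival_zero] using hw.lt_arrival_firstAfter r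

lemma arrival_le_of_lt_firstAfter {i : ℕ} (hi : i < firstAfter r w) : w.arrival i ≤ r :=
  not_lt.1 (Nat.notMem_of_lt_sInf hi)

lemma firstAfter_le_iff {n : ℕ} :
    firstAfter r w ≤ n ↔ (∃ i ≤ n, r < w.arrival i) ∨ ∀ i, w.arrival i ≤ r := by
  refine ⟨fun h => ?_, ?_⟩
  · by_cases hne : ∃ i, r < w.arrival i
    · exact Or.inl ⟨_, h, Nat.sInf_mem hne⟩
    · exact Or.inr (by simpa using hne)
  · rintro (⟨i, hin, hi⟩ | h)
    · exact (Nat.sInf_le hi).trans hin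
    · simp [firstAfter, (h _).not_gt]

lemma arrival_shift (r : ℝ) (w : MarkedStream E) (i : ℕ) :
    (shift r w).arrival i = w.arrival (firstAfter r w + i) - r := by
  induction i with
  | zero => simp [arrival_zero, shift]
  | succ i ih =>
    rw [arrival_succ, ih, ← add_assoc, arrival_succ, add_sub_right_comm]
    simp [shift, add_assoc]

lemma shift_apply_zero (r : ℝ) (w : MarkedStream E) :
    shift r w 0 = (w.arrival (firstAfter r w) - r, (w (firstAfter r w)).2) := rfl

lemma shift_snd (r : ℝ) (w : MarkedStream E) (i : ℕ) :
    (shift r w i).2 = (w (firstAfter r w + i)).2 := rfl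

lemma ext_arrival {v w : MarkedStream E} (harr : ∀ i, v.arrival i = w.arrival i)
    (hmark : ∀ i, (v i).2 = (w i).2) : v = w := by
  funext i
  refine Prod.ext ?_ (hmark i)
  cases i with
  | zero => rw [← arrival_zero, ← arrival_zero, harr]
  | succ i =>
    have := harr (i + 1)
    rwa [arrival_succ, arrival_succ, harr i, add_right_inj] at this

lemma Unbounded.shift_shift (hw : w.Unbounded) {a b : ℝ} (hb : 0 ≤ b) :
    shift b (shift a w) = shift (a + b) w := by
  have hle : firstAfter a w ≤ firstAfter (a + b) w := by
    by_contra! h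
    linarith [arrival_le_of_lt_firstAfter h, hw.lt_arrival_firstAfter (a + b)]
  have hfirst : firstAfter b (shift a w) = firstAfter (a + b) w - firstAfter a w := by
    apply firstAfter_eq_of
    · rw [arrival_shift, Nat.add_sub_cancel' hle]
      linarith [hw.lt_arrival_firstAfter (a + b)]
    · intro i hi
      rw [arrival_shift]
      have hi' : firstAfter a w + i < firstAfter (a + b) w := by omega
      linarith [arrival_le_of_lt_firstAfter hi']
  have hadd : firstAfter a w + firstAfter b (shift a w) = firstAfter (a + b) w := by omega
  apply ext_arrival <;> intro i
  · rw [arrival_shift, arrival_shift, arrival_shift, ← add_assoc, hadd, sub_sub]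
  · rw [shift_snd, shift_snd, shift_snd, ← add_assoc, hadd]

lemma shift_prepend_of_lt {z : ℝ × E} (h : r < z.1) (w : MarkedStream E) :
    shift r (prepend z w) = prepend (z.1 - r, z.2) w := by
  have hfirst : firstAfter r (prepend z w) = 0 :=
    firstAfter_eq_of (h.trans_eq (arrival_prepend_zero z w).symm) (by simp)
  apply ext_arrival <;> intro i
  · rw [arrival_shift, hfirst, zero_add]
    cases i with
    | zero => rw [arrival_prepend_zero, arrival_prepend_zero]
    | succ i => rw [arrival_prepend_succ, arrival_prepend_succ, add_sub_right_comm]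
  · rw [shift_snd, hfirst, zero_add]
    cases i <;> rfl

lemma Unbounded.firstAfter_prepend (hw : w.Unbounded) {z : ℝ × E} (h : z.1 ≤ r) :
    firstAfter r (prepend z w) = firstAfter (r - z.1) w + 1 := by
  apply firstAfter_eq_of
  · rw [arrival_prepend_succ]
    linarith [hw.lt_arrival_firstAfter (r - z.1)]
  · intro i hi
    cases i with
    | zero => exact (arrival_prepend_zero z w).trans_le h
    | succ i =>
      rw [arrival_prepend_succ]
      linarith [arrival_le_of_lt_firstAfter (Nat.lt_of_succ_lt_succ hi)]

lemma Unbounded.shift_prepend (hw : w.Unbounded) {z : ℝ × E} (h : z.1 ≤ r) :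
    shift r (prepend z w) = shift (r - z.1) w := by
  apply ext_arrival <;> intro i
  · rw [arrival_shift, arrival_shift, hw.firstAfter_prepend h, add_right_comm,
      arrival_prepend_succ]
    ring
  · rw [shift_snd, shift_snd, hw.firstAfter_prepend h, add_right_comm]
    rfl

end Path

variable [MeasurableSpace E]

section Measurability

@[fun_prop]
lemma measurable_arrival (i : ℕ) : Measurable fun w : MarkedStream E => w.arrival i := by
  unfold arrival arrivalTime
  fun_prop

lemma measurableSet_lt_arrival (i : ℕ) :
    MeasurableSet {p : ℝ × MarkedStream E | p.1 < p.2.arrival i} :=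
  measurableSet_lt measurable_fst ((measurable_arrival i).comp measurable_snd)

lemma measurable_firstAfter : Measurable fun p : ℝ × MarkedStream E => firstAfter p.1 p.2 := by
  refine measurable_of_Iic fun n => ?_
  have hpre : (fun p : ℝ × MarkedStream E => firstAfter p.1 p.2) ⁻¹' Set.Iic n =
      (⋃ i ≤ n, {p | p.1 < p.2.arrival i}) ∪ ⋂ i, {p | p.1 < p.2.arrival i}ᶜ := by
    ext p
    simp [firstAfter_le_iff]
  rw [hpre]
  exact (MeasurableSet.biUnion (Set.to_countable _) fun i _ => measurableSet_lt_arrival i).union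
    (MeasurableSet.iInter fun i => (measurableSet_lt_arrival i).compl)

lemma measurable_shift : Measurable fun p : ℝ × MarkedStream E => shift p.1 p.2 := by
  have heval : Measurable fun q : MarkedStream E × ℕ => q.1 q.2 :=
    measurable_from_prod_countable_left measurable_pi_apply
  have harr : Measurable fun q : MarkedStream E × ℕ => q.1.arrival q.2 :=
    measurable_from_prod_countable_left measurable_arrival
  refine measurable_pi_lambda _ fun i => ?_
  have hpacket : Measurable fun p : ℝ × MarkedStream E => p.2 (firstAfter p.1 p.2 + i) :=
    heval.comp (measurable_snd.prodMk
      ((measurable_of_countable (· + i)).comp measurable_firstAfter))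
  refine Measurable.prodMk ?_ hpacket.snd
  split_ifs
  · exact (harr.comp (measurable_snd.prodMk measurable_firstAfter)).sub measurable_fst
  · exact hpacket.fst

@[fun_prop]
lemma measurable_shift_comp {X : Type*} [MeasurableSpace X] {r : X → ℝ} {f : X → MarkedStream E}
    (hr : Measurable r) (hf : Measurable f) : Measurable fun x => shift (r x) (f x) :=
  measurable_shift.comp (hr.prodMk hf)

lemma measurable_shift_const (r : ℝ) : Measurable (shift r : MarkedStream E → MarkedStream E) :=
  measurable_shift_comp measurable_const measurable_id

end Measurability

lemma ae_unbounded {ρ : Measure (ℝ × E)} [IsProbabilityMeasure ρ]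
    (hint : Integrable (fun z : ℝ × E => z.1) ρ) (hmean : 0 < ∫ z, z.1 ∂ρ) :
    ∀ᵐ w ∂iidLaw ρ, Unbounded w := by
  have hfst : Measurable fun z : ℝ × E => z.1 := measurable_fst
  have heval := measurePreserving_eval_iidLaw ρ
  have hind : iIndepFun (fun (i : ℕ) (w : MarkedStream E) => (w i).1) (iidLaw ρ) :=
    iIndepFun_infinitePi (P := fun _ => ρ) (X := fun _ z => z.1) fun _ => hfst
  have hident (i : ℕ) : IdentDistrib (fun w : MarkedStream E => (w i).1) (fun w => (w 0).1)
      (iidLaw ρ) (iidLaw ρ) :=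
    (IdentDistrib.mk (heval i).aemeasurable (heval 0).aemeasurable
      ((heval i).map_eq.trans (heval 0).map_eq.symm)).comp hfst
  have hmean₀ : ∫ w, (w 0).1 ∂iidLaw ρ = ∫ z, z.1 ∂ρ := by
    conv_rhs => rw [← (heval 0).map_eq]
    rw [integral_map (heval 0).aemeasurable hfst.aestronglyMeasurable]
  filter_upwards [strong_law_ae_real _ ((heval 0).integrable_comp_of_integrable hint)
    (fun i j hij => hind.indepFun hij) hident] with w hw
  have hsum : Tendsto (fun n : ℕ => ∑ i ∈ Finset.range n, (w i).1) atTop atTop := by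
    refine (hw.pos_mul_atTop (hmean₀ ▸ hmean) tendsto_natCast_atTop_atTop).congr' ?_
    filter_upwards [eventually_ne_atTop 0] with n hn
    exact div_mul_cancel₀ _ (Nat.cast_ne_zero.2 hn)
  exact fun u => (((tendsto_add_atTop_iff_nat 1).2 hsum).eventually_gt_atTop u).exists

/-- The law of the stream of points of a Poisson process of rate `r` with independent marks of
law `G`. -/
def poissonLaw (r : ℝ) (G : Measure E) : Measure (MarkedStream E) := iidLaw ((expMeasure r).prod G)

variable {r : ℝ} {G : Measure E} [IsProbabilityMeasure G]

lemma isProbabilityMeasure_poissonLaw (hr : 0 < r) : IsProbabilityMeasure (poissonLaw r G) := by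
  have := isProbabilityMeasure_expMeasure hr
  exact isProbabilityMeasure_iidLaw _

lemma ae_unbounded_poissonLaw (hr : 0 < r) : ∀ᵐ w ∂poissonLaw r G, w.Unbounded := by
  have := isProbabilityMeasure_expMeasure hr
  refine ae_unbounded ((integrable_id_expMeasure hr).comp_fst G) ?_
  have hmean : ∫ z : ℝ × E, z.1 ∂(expMeasure r).prod G = 1 / r := by
    rw [integral_fun_fst (fun a : ℝ => a), probReal_univ, one_smul, integral_id_expMeasure hr]
  rw [hmean]
  positivity

lemma poissonLaw_apply (hr : 0 < r) {B : Set (MarkedStream E)} (hB : MeasurableSet B) :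
    poissonLaw r G B = ∫⁻ z, poissonLaw r G {w | prepend z w ∈ B} ∂(expMeasure r).prod G := by
  have := isProbabilityMeasure_expMeasure hr
  exact iidLaw_apply hB

lemma measurableSet_lt_and_shift_mem {X : Type*} [MeasurableSpace X] {t u : X → ℝ}
    {f : X → MarkedStream E} (ht : Measurable t) (hu : Measurable u) (hf : Measurable f)
    {B : Set (MarkedStream E)} (hB : MeasurableSet B) :
    MeasurableSet {x | t x < (f x 0).1 ∧ shift (u x) (f x) ∈ B} := by
  have hgap : Measurable fun x => (f x 0).1 := by fun_prop
  exact (measurableSet_lt ht hgap).inter (measurable_shift_comp hu hf hB)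

lemma map_sub_restrict_prod_expMeasure (hr : 0 < r) {t : ℝ} (ht : 0 ≤ t) :
    (((expMeasure r).prod G).restrict (Set.Ioi t ×ˢ Set.univ)).map (Prod.map (· - t) id) =
      ENNReal.ofReal (Real.exp (-(r * t))) • (expMeasure r).prod G := by
  have := isProbabilityMeasure_expMeasure hr
  have hsub : Measurable fun a : ℝ => a - t := measurable_id.sub_const t
  rw [← Measure.prod_restrict, ← Measure.map_prod_map _ _ hsub measurable_id,
    map_sub_restrict_Ioi_expMeasure hr ht, Measure.restrict_univ, Measure.map_id,
    Measure.prod_smul_left]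

lemma poissonLaw_lt_and_shift_self_mem (hr : 0 < r) {t : ℝ} (ht : 0 ≤ t) {B : Set (MarkedStream E)}
    (hB : MeasurableSet B) :
    poissonLaw r G {w | t < (w 0).1 ∧ shift t w ∈ B} =
      ENNReal.ofReal (Real.exp (-(r * t))) * poissonLaw r G B := by
  have := isProbabilityMeasure_expMeasure hr
  have := isProbabilityMeasure_poissonLaw (G := G) hr
  have hsub : Measurable fun a : ℝ => a - t := measurable_id.sub_const t
  have hφ : Measurable fun z : ℝ × E => poissonLaw r G {w | prepend z w ∈ B} :=
    measurable_measure_prodMk_left (measurable_prepend hB)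
  have hfiber (z : ℝ × E) : poissonLaw r G {w | t < (prepend z w 0).1 ∧ shift t (prepend z w) ∈ B} =
      (Set.Ioi t ×ˢ Set.univ).indicator
        (fun z => poissonLaw r G {w | prepend (Prod.map (· - t) id z) w ∈ B}) z := by
    by_cases hz : t < z.1
    · rw [Set.indicator_of_mem (show z ∈ Set.Ioi t ×ˢ Set.univ from ⟨hz, trivial⟩)]
      congr 1 with w
      simp only [shift_prepend_of_lt hz, Set.mem_ofPred_eq]
      exact and_iff_right hz
    · rw [Set.indicator_of_notMem (show z ∉ Set.Ioi t ×ˢ Set.univ from fun h => hz h.1)]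
      simp [prepend, hz]
  calc poissonLaw r G {w | t < (w 0).1 ∧ shift t w ∈ B}
      = ∫⁻ z in Set.Ioi t ×ˢ Set.univ,
          poissonLaw r G {w | prepend (Prod.map (· - t) id z) w ∈ B} ∂(expMeasure r).prod G := by
        rw [← lintegral_indicator (measurableSet_Ioi.prod .univ),
          poissonLaw_apply hr (measurableSet_lt_and_shift_mem measurable_const measurable_const
            (f := fun w => w) measurable_id hB)]
        exact lintegral_congr hfiber
    _ = ENNReal.ofReal (Real.exp (-(r * t))) * poissonLaw r G B := by
        rw [← lintegral_map hφ (hsub.prodMap measurable_id),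
          map_sub_restrict_prod_expMeasure hr ht, lintegral_smul_measure, smul_eq_mul,
          poissonLaw_apply hr hB]

lemma poissonLaw_firstAfter_eq_and_shift_mem (hr : 0 < r) {B : Set (MarkedStream E)}
    (hB : MeasurableSet B) (j : ℕ) {s : ℝ} (hs : 0 ≤ s) :
    poissonLaw r G {w | firstAfter s w = j ∧ shift s w ∈ B} =
      poissonLaw r G {w | firstAfter s w = j} * poissonLaw r G B := by
  have := isProbabilityMeasure_expMeasure hr
  have := isProbabilityMeasure_poissonLaw (G := G) hr
  have hunb := ae_unbounded_poissonLaw (G := G) hr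
  have hfirst (s : ℝ) : Measurable (firstAfter s : MarkedStream E → ℕ) :=
    measurable_firstAfter.comp measurable_prodMk_left
  induction j generalizing s with
  | zero =>
    have hcongr (C : Set (MarkedStream E)) : poissonLaw r G {w | firstAfter s w = 0 ∧ w ∈ C} =
        poissonLaw r G {w | s < (w 0).1 ∧ w ∈ C} := measure_congr <| by
      filter_upwards [hunb] with w hw using propext (and_congr_left' hw.firstAfter_eq_zero_iff)
    have huniv := (hcongr Set.univ).trans (poissonLaw_lt_and_shift_self_mem hr hs .univ)
    rw [measure_univ, mul_one] at huniv
    rw [show {w | firstAfter s w = 0} = {w : MarkedStream E | firstAfter s w = 0 ∧ w ∈ Set.univ} by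
      simp, huniv, ← poissonLaw_lt_and_shift_self_mem hr hs hB]
    exact hcongr (shift s ⁻¹' B)
  | succ j ih =>
    have hj : MeasurableSet {w : MarkedStream E | firstAfter s w = j + 1} :=
      hfirst s (measurableSet_singleton _)
    have hjB := hj.inter (measurable_shift_const s hB)
    rw [poissonLaw_apply hr hj, ← lintegral_mul_const' _ _ (measure_ne_top _ B)]
    refine (poissonLaw_apply hr hjB).trans (lintegral_congr fun z => ?_)
    rcases lt_or_ge s z.1 with hz | hz
    · have hzero (w : MarkedStream E) : firstAfter s (prepend z w) = 0 :=
        firstAfter_eq_of (hz.trans_eq (arrival_prepend_zero z w).symm) (by simp)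
      simp [hzero]
    · have hcongr (C : Set (MarkedStream E)) :
          poissonLaw r G {w | firstAfter s (prepend z w) = j + 1 ∧ shift s (prepend z w) ∈ C} =
            poissonLaw r G {w | firstAfter (s - z.1) w = j ∧ shift (s - z.1) w ∈ C} :=
        measure_congr <| by
          filter_upwards [hunb] with w hw
          refine propext ?_
          change _ ∧ _ ↔ _ ∧ _
          rw [hw.firstAfter_prepend hz, hw.shift_prepend hz, add_left_inj]
      have huniv := hcongr Set.univ
      simp only [Set.mem_univ, and_true] at huniv
      exact (hcongr B).trans ((ih (sub_nonneg.2 hz)).trans (congrArg (· * _) huniv.symm))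

lemma measurePreserving_shift (hr : 0 < r) {s : ℝ} (hs : 0 ≤ s) :
    MeasurePreserving (shift s) (poissonLaw r G) (poissonLaw r G) := by
  have := isProbabilityMeasure_poissonLaw (G := G) hr
  refine ⟨measurable_shift_const s, Measure.ext fun B hB => ?_⟩
  have hsum (ν : Measure (MarkedStream E)) :
      ∑' j, ν {w | firstAfter s w = j} = ν Set.univ := by
    rw [← tsum_univ]
    refine tsum_measure_preimage_singleton (μ := ν) Set.countable_univ fun j _ => ?_
    exact measurable_firstAfter.comp measurable_prodMk_left (measurableSet_singleton j)
  have hB' := measurable_shift_const s hB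
  have hrestrict (j : ℕ) :
      (poissonLaw r G).restrict (shift s ⁻¹' B) {w | firstAfter s w = j} =
        poissonLaw r G {w | firstAfter s w = j} * poissonLaw r G B := by
    rw [Measure.restrict_apply' hB']
    exact poissonLaw_firstAfter_eq_and_shift_mem hr hB j hs
  rw [Measure.map_apply (measurable_shift_const s) hB, ← Measure.restrict_apply_univ, ← hsum,
    tsum_congr hrestrict, ENNReal.tsum_mul_right, hsum, measure_univ, one_mul]

lemma poissonLaw_lt_and_shift_mem (hr : 0 < r) {t u : ℝ} (ht : 0 ≤ t) (hu : t ≤ u)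
    {B : Set (MarkedStream E)} (hB : MeasurableSet B) :
    poissonLaw r G {w | t < (w 0).1 ∧ shift u w ∈ B} =
      ENNReal.ofReal (Real.exp (-(r * t))) * poissonLaw r G B := by
  rw [← (measurePreserving_shift hr (sub_nonneg.2 hu)).measure_preimage hB.nullMeasurableSet,
    ← poissonLaw_lt_and_shift_self_mem hr ht (measurable_shift_const (u - t) hB)]
  refine measure_congr ?_
  filter_upwards [ae_unbounded_poissonLaw hr] with w hw
  refine propext (and_congr_right fun _ => ?_)
  rw [Set.mem_preimage, hw.shift_shift (sub_nonneg.2 hu), add_sub_cancel]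

lemma measurePreserving_eval_zero_prodMk_shift (hr : 0 < r) {τ : ℝ × E → ℝ} (hτ : Measurable τ)
    (hle : ∀ᵐ z ∂(expMeasure r).prod G, z.1 ≤ τ z) :
    MeasurePreserving (fun w : MarkedStream E => (w 0, shift (τ (w 0)) w)) (poissonLaw r G)
      (((expMeasure r).prod G).prod (poissonLaw r G)) := by
  have := isProbabilityMeasure_expMeasure hr
  have := isProbabilityMeasure_poissonLaw (G := G) hr
  have hmeas : Measurable fun w : MarkedStream E => (w 0, shift (τ (w 0)) w) :=
    (measurable_pi_apply 0).prodMk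
      (measurable_shift_comp (hτ.comp (measurable_pi_apply 0)) measurable_id)
  have hprepend : MeasurePreserving (fun p : (ℝ × E) × MarkedStream E => prepend p.1 p.2)
      (((expMeasure r).prod G).prod (poissonLaw r G)) (poissonLaw r G) :=
    measurePreserving_prepend _
  have hshift : Measurable
      (Function.uncurry fun (z : ℝ × E) (w : MarkedStream E) => shift (τ z - z.1) w) :=
    measurable_shift_comp ((hτ.comp measurable_fst).sub measurable_fst.fst) measurable_snd
  have hskew := (MeasurePreserving.id ((expMeasure r).prod G)).skew_product hshift
    (hle.mono fun z hz => (measurePreserving_shift (G := G) hr (sub_nonneg.2 hz)).map_eq)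
  refine ⟨hmeas, ?_⟩
  conv_lhs => rw [← hprepend.map_eq]
  rw [Measure.map_map hmeas hprepend.measurable]
  refine (Measure.map_congr ?_).trans hskew.map_eq
  filter_upwards [Measure.quasiMeasurePreserving_fst.ae hle,
    Measure.quasiMeasurePreserving_snd.ae (ae_unbounded_poissonLaw hr)] with p hp hunb
  exact Prod.ext rfl (hunb.shift_prepend hp)

lemma setLIntegral_poissonLaw (hr : 0 < r) {τ : ℝ × E → ℝ} (hτ : Measurable τ)
    (hle : ∀ᵐ z ∂(expMeasure r).prod G, z.1 ≤ τ z) {A : Set (ℝ × E)} (hA : MeasurableSet A)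
    {B : Set (MarkedStream E)} (hB : MeasurableSet B) {f : ℝ × E → ℝ≥0∞} (hf : Measurable f) :
    ∫⁻ w in {w | w 0 ∈ A ∧ shift (τ (w 0)) w ∈ B}, f (w 0) ∂poissonLaw r G =
      (∫⁻ z in A, f z ∂(expMeasure r).prod G) * poissonLaw r G B := by
  have := isProbabilityMeasure_expMeasure hr
  have := isProbabilityMeasure_poissonLaw (G := G) hr
  have hmp := measurePreserving_eval_zero_prodMk_shift hr hτ hle
  have hf' : Measurable fun p : (ℝ × E) × MarkedStream E => f p.1 := hf.comp measurable_fst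
  refine (hmp.setLIntegral_comp_preimage (hA.prod hB) hf').trans ?_
  rw [← Measure.prod_restrict, lintegral_prod _ hf'.aemeasurable]
  simp only [lintegral_const, Measure.restrict_apply_univ]
  exact lintegral_mul_const _ hf

lemma prod_poissonLaw_lt_and_shift_mem {ι : Type*} {lam : ι → ℝ} {G : ι → Measure E}
    [∀ i, IsProbabilityMeasure (G i)] (hlam : ∀ i, 0 < lam i) (s : Finset ι) {t u : ℝ}
    (ht : 0 ≤ t) (hu : t ≤ u) {B : ι → Set (MarkedStream E)} (hB : ∀ i, MeasurableSet (B i)) :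
    ∏ k ∈ s, poissonLaw (lam k) (G k) {w | t < (w 0).1 ∧ shift u w ∈ B k} =
      ENNReal.ofReal (Real.exp (-((∑ k ∈ s, lam k) * t))) *
        ∏ k ∈ s, poissonLaw (lam k) (G k) (B k) := by
  simp only [poissonLaw_lt_and_shift_mem (hlam _) ht hu (hB _), Finset.prod_mul_distrib]
  rw [← ENNReal.ofReal_prod_of_nonneg fun _ _ => (Real.exp_pos _).le, ← Real.exp_sum,
    Finset.sum_neg_distrib, Finset.sum_mul]

end MarkedStream

lemma setLIntegral_exp_expMeasure_prod {E : Type*} [MeasurableSpace E] {r θ : ℝ} (hr : 0 < r)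
    (hθ : 0 ≤ θ) (G : Measure E) [SFinite G] {A : Set (ℝ × E)} (hA : MeasurableSet A) :
    ∫⁻ z in A, ENNReal.ofReal (Real.exp (-(θ * z.1))) ∂(expMeasure r).prod G =
      ENNReal.ofReal (r / (r + θ)) * (expMeasure (r + θ)).prod G A := by
  have := isProbabilityMeasure_expMeasure hr
  rw [← withDensity_apply _ hA,
    ← prod_withDensity_left (f := fun a => ENNReal.ofReal (Real.exp (-(θ * a)))) (by fun_prop),
    withDensity_exp_expMeasure hr hθ, Measure.prod_smul_left, Measure.smul_apply, smul_eq_mul]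

/-- The input of a server: for every class, the stream of its packets, marked by their service
times. -/
abbrev Input (ι : Type*) := ι → MarkedStream ℝ

namespace Input

open MarkedStream

variable {ι : Type*} {W : Input ι}

/-- The first arriving packet of the input is of class `i`. -/
def IsFirst (W : Input ι) (i : ι) : Prop := ∀ k ≠ i, (W i 0).1 < (W k 0).1

lemma IsFirst.unique {i j : ι} (hi : IsFirst W i) (hj : IsFirst W j) : i = j := by
  by_contra h
  exact lt_asymm (hi j (Ne.symm h)) (hj i h)

lemma pairwise_disjoint_isFirst : Pairwise (Disjoint on fun i => {W : Input ι | W.IsFirst i}) :=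
  fun _ _ hij => Set.disjoint_left.2 fun _ hi hj => hij (IsFirst.unique hi hj)

lemma measurableSet_isFirst [Countable ι] (i : ι) : MeasurableSet {W : Input ι | W.IsFirst i} := by
  simp only [IsFirst, Set.ofPred_forall]
  exact MeasurableSet.iInter fun k => MeasurableSet.iInter fun _ =>
    measurableSet_lt (by fun_prop) (by fun_prop)

variable [Nonempty ι]

/-- The class of the first arriving packet (junk value if several packets arrive first). -/
def firstClass (W : Input ι) : ι := Classical.epsilon W.IsFirst

/-- The class, the arrival time and the service time of the first arriving packet. -/
def firstPacket (W : Input ι) : ι × (ℝ × ℝ) := (W.firstClass, W W.firstClass 0)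

/-- The time at which the first arriving packet leaves a server that is idle at the origin. -/
def firstDeparture (W : Input ι) : ℝ := W.firstPacket.2.1 + W.firstPacket.2.2

/-- The input as seen from the departure of its first arriving packet on. -/
def next (W : Input ι) : Input ι := fun k => shift W.firstDeparture (W k)

lemma IsFirst.firstClass_eq {i : ι} (hi : IsFirst W i) : firstClass W = i :=
  IsFirst.unique (Classical.epsilon_spec ⟨i, hi⟩) hi

lemma IsFirst.firstPacket_eq {i : ι} (hi : IsFirst W i) : firstPacket W = (i, W i 0) := by
  rw [firstPacket, hi.firstClass_eq]

variable [MeasurableSpace ι] [Countable ι]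

lemma measurable_firstClass : Measurable (firstClass : Input ι → ι) := by
  refine measurable_to_countable' fun i => ?_
  have hpre : firstClass ⁻¹' {i} = {W : Input ι | W.IsFirst i} ∪
      ((⋃ k, {W : Input ι | W.IsFirst k})ᶜ ∩
        {_W | Classical.epsilon (fun _ : ι => False) = i}) := by
    ext W
    by_cases hW : ∃ k, W.IsFirst k
    · obtain ⟨k, hk⟩ := hW
      have hmem : W ∈ ⋃ k, {W : Input ι | W.IsFirst k} := Set.mem_iUnion.2 ⟨k, hk⟩
      have hiff : W.IsFirst i ↔ k = i := ⟨hk.unique, fun h => h ▸ hk⟩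
      simp only [Set.mem_preimage, Set.mem_singleton_iff, hk.firstClass_eq, Set.mem_union,
        Set.mem_inter_iff, Set.mem_compl_iff, hmem, not_true_eq_false, false_and, or_false,
        Set.mem_ofPred_eq, hiff]
    · have hfalse : W.IsFirst = fun _ => False := by simpa [funext_iff] using hW
      simp [firstClass, hfalse]
  rw [hpre]
  exact (measurableSet_isFirst i).union
    ((MeasurableSet.iUnion measurableSet_isFirst).compl.inter (MeasurableSet.const _))

variable [MeasurableSingletonClass ι]

lemma measurable_firstPacket : Measurable (firstPacket : Input ι → ι × (ℝ × ℝ)) := by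
  have heval : Measurable fun q : Input ι × ι => q.1 q.2 0 :=
    measurable_from_prod_countable_left fun i =>
      (measurable_pi_apply 0).comp (measurable_pi_apply i)
  have hfirst : Measurable fun W : Input ι => (W, W.firstClass) :=
    measurable_id.prodMk measurable_firstClass
  exact measurable_firstClass.prodMk (heval.comp hfirst)

lemma measurable_firstDeparture : Measurable (firstDeparture : Input ι → ℝ) := by
  have hadd : Measurable fun p : ι × (ℝ × ℝ) => p.2.1 + p.2.2 := by fun_prop
  exact hadd.comp measurable_firstPacket

lemma measurable_next : Measurable (next : Input ι → Input ι) :=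
  measurable_pi_lambda _ fun k =>
    measurable_shift_comp measurable_firstDeparture (measurable_pi_apply k)

end Input

section Laws

variable {ι : Type*} [Fintype ι] (lam : ι → ℝ) (G : ι → Measure ℝ)

/-- The law of independent Poisson streams of rates `lam` with independent service times of
laws `G`. -/
def inputLaw : Measure (Input ι) := Measure.pi fun i => MarkedStream.poissonLaw (lam i) (G i)

/-- The law of the class, the arrival time and the service time of the first arriving packet. -/
def packetLaw [MeasurableSpace ι] : Measure (ι × (ℝ × ℝ)) :=
  ∑ i, ENNReal.ofReal (lam i / ∑ k, lam k) • ((expMeasure (∑ k, lam k)).prod (G i)).map (Prod.mk i)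

variable {lam G}

section PacketLaw

variable [MeasurableSpace ι] {f : ι × (ℝ × ℝ) → ℝ}

lemma packetLaw_apply {A : Set (ι × (ℝ × ℝ))} (hA : MeasurableSet A) :
    packetLaw lam G A = ∑ i, ENNReal.ofReal (lam i / ∑ k, lam k) *
      (expMeasure (∑ k, lam k)).prod (G i) (Prod.mk i ⁻¹' A) := by
  simp only [packetLaw, Measure.coe_finsetSum, Finset.sum_apply, Measure.smul_apply, smul_eq_mul]
  exact Finset.sum_congr rfl fun i _ => by rw [Measure.map_apply measurable_prodMk_left hA]

lemma integrable_packetLaw (hf : Measurable f)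
    (hint : ∀ i, Integrable (fun z => f (i, z)) ((expMeasure (∑ k, lam k)).prod (G i))) :
    Integrable f (packetLaw lam G) :=
  integrable_finsetSum_measure.2 fun i _ =>
    ((integrable_map_measure hf.aestronglyMeasurable measurable_prodMk_left.aemeasurable).2
      (hint i)).smul_measure ENNReal.ofReal_ne_top

lemma integral_packetLaw (hlam : ∀ i, 0 ≤ lam i) (hf : Measurable f)
    (hint : ∀ i, Integrable (fun z => f (i, z)) ((expMeasure (∑ k, lam k)).prod (G i))) :
    ∫ z, f z ∂packetLaw lam G =
      ∑ i, lam i / (∑ k, lam k) * ∫ z, f (i, z) ∂(expMeasure (∑ k, lam k)).prod (G i) := by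
  rw [packetLaw, integral_finsetSum_measure (integrable_finsetSum_measure.1
    (integrable_packetLaw hf hint))]
  refine Finset.sum_congr rfl fun i _ => ?_
  rw [integral_smul_measure, ENNReal.toReal_ofReal
    (div_nonneg (hlam i) (Finset.sum_nonneg fun k _ => hlam k)), smul_eq_mul,
    integral_map measurable_prodMk_left.aemeasurable hf.aestronglyMeasurable]

end PacketLaw

section Regeneration

open MarkedStream

variable [∀ i, IsProbabilityMeasure (G i)]

lemma ae_pos_and_nonneg_expMeasure_prod {r : ℝ} (hr : 0 < r) {ν : Measure ℝ} [SFinite ν]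
    (hν : ∀ᵐ s ∂ν, 0 ≤ s) : ∀ᵐ z ∂(expMeasure r).prod ν, 0 < z.1 ∧ 0 ≤ z.2 :=
  (Measure.quasiMeasurePreserving_fst.ae (ae_pos_expMeasure hr)).and
    (Measure.quasiMeasurePreserving_snd.ae hν)

lemma ae_forall_pos_and_nonneg_poissonLaw {r : ℝ} (hr : 0 < r) {ν : Measure ℝ}
    [IsProbabilityMeasure ν] (hν : ∀ᵐ s ∂ν, 0 ≤ s) :
    ∀ᵐ w ∂poissonLaw r ν, ∀ i, 0 < (w i).1 ∧ 0 ≤ (w i).2 := by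
  have := isProbabilityMeasure_expMeasure hr
  exact ae_iidLaw_forall (ae_pos_and_nonneg_expMeasure_prod hr hν)

lemma setLIntegral_exp_poissonLaw {r θ : ℝ} (hr : 0 < r) (hθ : 0 ≤ θ) {ν : Measure ℝ}
    [IsProbabilityMeasure ν] (hν : ∀ᵐ s ∂ν, 0 ≤ s) {A : Set (ℝ × ℝ)} (hA : MeasurableSet A)
    {B : Set (MarkedStream ℝ)} (hB : MeasurableSet B) :
    ∫⁻ w in {w | w 0 ∈ A ∧ shift ((w 0).1 + (w 0).2) w ∈ B},
        ENNReal.ofReal (Real.exp (-(θ * (w 0).1))) ∂poissonLaw r ν =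
      ENNReal.ofReal (r / (r + θ)) * (expMeasure (r + θ)).prod ν A * poissonLaw r ν B := by
  rw [setLIntegral_poissonLaw hr (τ := fun z => z.1 + z.2) (by fun_prop)
    ((ae_pos_and_nonneg_expMeasure_prod hr hν).mono fun z hz => le_add_of_nonneg_right hz.2) hA hB
    (f := fun z => ENNReal.ofReal (Real.exp (-(θ * z.1)))) (by fun_prop),
    setLIntegral_exp_expMeasure_prod hr hθ ν hA]

lemma inputLaw_isFirst_and_shift_mem (hlam : ∀ i, 0 < lam i)
    (hG : ∀ i, ∀ᵐ s ∂G i, 0 ≤ s) (i : ι) {A : Set (ℝ × ℝ)} (hA : MeasurableSet A)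
    {B : ι → Set (MarkedStream ℝ)} (hB : ∀ k, MeasurableSet (B k)) :
    inputLaw lam G {W | W.IsFirst i ∧ W i 0 ∈ A ∧ ∀ k, shift ((W i 0).1 + (W i 0).2) (W k) ∈ B k} =
      ENNReal.ofReal (lam i / ∑ k, lam k) * (expMeasure (∑ k, lam k)).prod (G i) A *
        ∏ k, poissonLaw (lam k) (G k) (B k) := by
  classical
  have hprob k := isProbabilityMeasure_poissonLaw (G := G k) (hlam k)
  set C : Set (MarkedStream ℝ) := {w | w 0 ∈ A ∧ shift ((w 0).1 + (w 0).2) w ∈ B i} with hC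
  set D : ι → Set (MarkedStream ℝ × MarkedStream ℝ) := fun k =>
    {p | (p.1 0).1 < (p.2 0).1 ∧ shift ((p.1 0).1 + (p.1 0).2) p.2 ∈ B k} with hD
  have hCmeas : MeasurableSet C := (measurable_pi_apply 0 hA).inter
    (measurable_shift_comp (by fun_prop) measurable_id (hB i))
  have hDmeas k : MeasurableSet (D k) :=
    measurableSet_lt_and_shift_mem (by fun_prop) (by fun_prop) measurable_snd (hB k)
  have hset : {W : Input ι | W.IsFirst i ∧ W i 0 ∈ A ∧
      ∀ k, shift ((W i 0).1 + (W i 0).2) (W k) ∈ B k} =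
        {W | W i ∈ C ∧ ∀ k ≠ i, (W i, W k) ∈ D k} := by
    ext W
    simp only [Input.IsFirst, hC, hD, Set.mem_ofPred_eq]
    grind
  have hfiber : ∀ᵐ w ∂poissonLaw (lam i) (G i), w ∈ C →
      ∏ k ∈ Finset.univ.erase i, poissonLaw (lam k) (G k) (Prod.mk w ⁻¹' D k) =
        ENNReal.ofReal (Real.exp (-((∑ k ∈ Finset.univ.erase i, lam k) * (w 0).1))) *
          ∏ k ∈ Finset.univ.erase i, poissonLaw (lam k) (G k) (B k) := by
    filter_upwards [ae_forall_pos_and_nonneg_poissonLaw (hlam i) (hG i)] with w hw _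
    exact prod_poissonLaw_lt_and_shift_mem hlam _ (hw 0).1.le
      (le_add_of_nonneg_right (hw 0).2) hB
  rw [hset, inputLaw, pi_setOf_forall_ne_mem _ i hCmeas hDmeas,
    setLIntegral_congr_fun_ae hCmeas hfiber, lintegral_mul_const _ (by fun_prop), hC,
    setLIntegral_exp_poissonLaw (hlam i) (Finset.sum_nonneg fun k _ => (hlam k).le) (hG i) hA
      (hB i), Finset.add_sum_erase _ _ (Finset.mem_univ i), mul_assoc,
    Finset.mul_prod_erase _ (fun k => poissonLaw (lam k) (G k) (B k)) (Finset.mem_univ i)]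

lemma isProbabilityMeasure_inputLaw (hlam : ∀ i, 0 < lam i) :
    IsProbabilityMeasure (inputLaw lam G) := by
  have hprob k := isProbabilityMeasure_poissonLaw (G := G k) (hlam k)
  unfold inputLaw
  infer_instance

variable [Nonempty ι]

lemma sum_ofReal_div_sum_eq_one (hlam : ∀ i, 0 < lam i) :
    ∑ i, ENNReal.ofReal (lam i / ∑ k, lam k) = 1 := by
  have hpos : 0 < ∑ k, lam k := Finset.sum_pos (fun k _ => hlam k) Finset.univ_nonempty
  rw [← ENNReal.ofReal_sum_of_nonneg fun i _ => div_nonneg (hlam i).le hpos.le,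
    ← Finset.sum_div, div_self hpos.ne', ENNReal.ofReal_one]

lemma ae_exists_isFirst (hlam : ∀ i, 0 < lam i) (hG : ∀ i, ∀ᵐ s ∂G i, 0 ≤ s) :
    ∀ᵐ W ∂inputLaw lam G, ∃ i, W.IsFirst i := by
  have := isProbabilityMeasure_inputLaw (G := G) hlam
  have hprob k := isProbabilityMeasure_poissonLaw (G := G k) (hlam k)
  have := isProbabilityMeasure_expMeasure
    (Finset.sum_pos (fun k _ => hlam k) (Finset.univ_nonempty (α := ι)))
  have hone i : inputLaw lam G {W | W.IsFirst i} = ENNReal.ofReal (lam i / ∑ k, lam k) := by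
    simpa using inputLaw_isFirst_and_shift_mem hlam hG i .univ (B := fun _ => Set.univ)
      fun _ => .univ
  refine (mem_ae_iff_prob_eq_one (?_ : MeasurableSet {W : Input ι | ∃ i, W.IsFirst i})).2 ?_
  · simpa only [Set.ofPred_exists] using MeasurableSet.iUnion Input.measurableSet_isFirst
  · rw [Set.ofPred_exists, measure_iUnion Input.pairwise_disjoint_isFirst
      Input.measurableSet_isFirst, tsum_fintype, Finset.sum_congr rfl fun i _ => hone i,
      sum_ofReal_div_sum_eq_one hlam]

lemma inputLaw_eq_sum_isFirst (hlam : ∀ i, 0 < lam i) (hG : ∀ i, ∀ᵐ s ∂G i, 0 ≤ s)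
    {C : Set (Input ι)} (hC : MeasurableSet C) :
    inputLaw lam G C = ∑ i, inputLaw lam G {W | W.IsFirst i ∧ W ∈ C} := by
  have hae : C =ᵐ[inputLaw lam G] ⋃ i, {W | W.IsFirst i ∧ W ∈ C} := by
    filter_upwards [ae_exists_isFirst hlam hG] with W hW
    refine propext (Iff.trans ?_ Set.mem_iUnion.symm)
    exact ⟨fun h => hW.imp fun i hi => ⟨hi, h⟩, fun ⟨_, _, h⟩ => h⟩
  have hdisj : Pairwise (Disjoint on fun i => {W : Input ι | W.IsFirst i ∧ W ∈ C}) :=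
    Input.pairwise_disjoint_isFirst.mono fun _ _ h => h.mono (fun _ hW => hW.1) fun _ hW => hW.1
  have hmeas i : MeasurableSet {W : Input ι | W.IsFirst i ∧ W ∈ C} :=
    (Input.measurableSet_isFirst i).inter hC
  rw [measure_congr hae, measure_iUnion hdisj hmeas, tsum_fintype]

variable [MeasurableSpace ι]

lemma isProbabilityMeasure_packetLaw (hlam : ∀ i, 0 < lam i) :
    IsProbabilityMeasure (packetLaw lam G) := by
  have := isProbabilityMeasure_expMeasure
    (Finset.sum_pos (fun k _ => hlam k) (Finset.univ_nonempty (α := ι)))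
  refine ⟨?_⟩
  simpa [packetLaw_apply MeasurableSet.univ] using sum_ofReal_div_sum_eq_one hlam

variable [MeasurableSingletonClass ι]

lemma inputLaw_firstPacket_mem_and_next_mem (hlam : ∀ i, 0 < lam i) (hG : ∀ i, ∀ᵐ s ∂G i, 0 ≤ s)
    {A : Set (ι × (ℝ × ℝ))} (hA : MeasurableSet A) {B : ι → Set (MarkedStream ℝ)}
    (hB : ∀ k, MeasurableSet (B k)) :
    inputLaw lam G {W | W.firstPacket ∈ A ∧ W.next ∈ Set.univ.pi B} =
      packetLaw lam G A * ∏ k, poissonLaw (lam k) (G k) (B k) := by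
  have hmeas : MeasurableSet {W : Input ι | W.firstPacket ∈ A ∧ W.next ∈ Set.univ.pi B} :=
    (Input.measurable_firstPacket hA).inter (Input.measurable_next (.univ_pi hB))
  rw [inputLaw_eq_sum_isFirst hlam hG hmeas, packetLaw_apply hA, Finset.sum_mul]
  refine Finset.sum_congr rfl fun i _ => ?_
  rw [← inputLaw_isFirst_and_shift_mem hlam hG i (measurable_prodMk_left hA) hB]
  congr 1 with W
  refine and_congr_right fun hi => ?_
  simp only [Set.mem_preimage, Set.mem_ofPred_eq, Set.mem_univ_pi, Input.next,
    Input.firstDeparture, Input.IsFirst.firstPacket_eq hi]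

lemma measurePreserving_firstPacket_prodMk_next (hlam : ∀ i, 0 < lam i)
    (hG : ∀ i, ∀ᵐ s ∂G i, 0 ≤ s) :
    MeasurePreserving (fun W : Input ι => (W.firstPacket, W.next)) (inputLaw lam G)
      ((packetLaw lam G).prod (inputLaw lam G)) := by
  have := isProbabilityMeasure_packetLaw (G := G) hlam
  have hprob k := isProbabilityMeasure_poissonLaw (G := G k) (hlam k)
  have hmeas : Measurable fun W : Input ι => (W.firstPacket, W.next) :=
    Input.measurable_firstPacket.prodMk Input.measurable_next
  refine ⟨hmeas, (Measure.prod_eq_generateFrom MeasurableSpace.generateFrom_measurableSet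
    generateFrom_pi MeasurableSpace.isPiSystem_measurableSet isPiSystem_pi
    (packetLaw lam G).toFiniteSpanningSetsIn
    (Measure.FiniteSpanningSetsIn.pi fun i => (poissonLaw (lam i) (G i)).toFiniteSpanningSetsIn)
    ?_).symm⟩
  rintro A (hA : MeasurableSet A) _ ⟨B, hB, rfl⟩
  have hB' k : MeasurableSet (B k) := hB k (Set.mem_univ k)
  rw [Measure.map_apply hmeas (hA.prod (.univ_pi hB')), inputLaw, Measure.pi_pi]
  exact inputLaw_firstPacket_mem_and_next_mem hlam hG hA hB'

lemma measurePreserving_firstPacket (hlam : ∀ i, 0 < lam i) (hG : ∀ i, ∀ᵐ s ∂G i, 0 ≤ s) :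
    MeasurePreserving Input.firstPacket (inputLaw lam G) (packetLaw lam G) := by
  have := isProbabilityMeasure_inputLaw (G := G) hlam
  exact measurePreserving_fst.comp (measurePreserving_firstPacket_prodMk_next hlam hG)

lemma measurePreserving_next (hlam : ∀ i, 0 < lam i) (hG : ∀ i, ∀ᵐ s ∂G i, 0 ≤ s) :
    MeasurePreserving Input.next (inputLaw lam G) (inputLaw lam G) := by
  have := isProbabilityMeasure_inputLaw (G := G) hlam
  have := isProbabilityMeasure_packetLaw (G := G) hlam
  exact measurePreserving_snd.comp (measurePreserving_firstPacket_prodMk_next hlam hG)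

lemma indepFun_firstPacket_next (hlam : ∀ i, 0 < lam i) (hG : ∀ i, ∀ᵐ s ∂G i, 0 ≤ s) :
    IndepFun Input.firstPacket Input.next (inputLaw lam G) := by
  have := isProbabilityMeasure_inputLaw (G := G) hlam
  rw [indepFun_iff_map_prod_eq_prod_map_map Input.measurable_firstPacket.aemeasurable
    Input.measurable_next.aemeasurable, (measurePreserving_firstPacket hlam hG).map_eq,
    (measurePreserving_next hlam hG).map_eq]
  exact (measurePreserving_firstPacket_prodMk_next hlam hG).map_eq

lemma ae_tendsto_birkhoffAverage_comp_firstPacket (hlam : ∀ i, 0 < lam i)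
    (hG : ∀ i, ∀ᵐ s ∂G i, 0 ≤ s) {f : ι × (ℝ × ℝ) → ℝ} (hf : Measurable f)
    (hint : ∀ i, Integrable (fun z => f (i, z)) ((expMeasure (∑ k, lam k)).prod (G i))) :
    ∀ᵐ W ∂inputLaw lam G,
      Tendsto (birkhoffAverage ℝ Input.next (f ∘ Input.firstPacket) · W) atTop
        (𝓝 (∑ i, lam i / (∑ k, lam k) * ∫ z, f (i, z) ∂(expMeasure (∑ k, lam k)).prod (G i))) := by
  have hfirst := measurePreserving_firstPacket hlam hG
  have hmean : ∫ W, (f ∘ Input.firstPacket) W ∂inputLaw lam G =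
      ∑ i, lam i / (∑ k, lam k) * ∫ z, f (i, z) ∂(expMeasure (∑ k, lam k)).prod (G i) := by
    rw [← integral_packetLaw (fun i => (hlam i).le) hf hint, ← hfirst.map_eq,
      integral_map hfirst.measurable.aemeasurable hf.aestronglyMeasurable]
    rfl
  rw [← hmean]
  exact ae_tendsto_birkhoffAverage (measurePreserving_next hlam hG)
    (hf.comp hfirst.measurable) (hfirst.integrable_comp_of_integrable
      (integrable_packetLaw hf hint)) ((indepFun_firstPacket_next hlam hG).comp hf measurable_id)

lemma ae_tendsto_birkhoffAverage_firstDeparture (hlam : ∀ i, 0 < lam i)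
    (hG : ∀ i, ∀ᵐ s ∂G i, 0 ≤ s) (hmean : ∀ i, Integrable (fun s => s) (G i)) :
    ∀ᵐ W ∂inputLaw lam G, Tendsto (birkhoffAverage ℝ Input.next Input.firstDeparture · W) atTop
      (𝓝 ((1 + ∑ i, lam i * ∫ s, s ∂G i) / ∑ k, lam k)) := by
  have hsum : 0 < ∑ k, lam k := Finset.sum_pos (fun k _ => hlam k) Finset.univ_nonempty
  have := isProbabilityMeasure_expMeasure hsum
  have hfst i : Integrable (fun z : ℝ × ℝ => z.1) ((expMeasure (∑ k, lam k)).prod (G i)) :=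
    (integrable_id_expMeasure hsum).comp_fst (G i)
  have hsnd i : Integrable (fun z : ℝ × ℝ => z.2) ((expMeasure (∑ k, lam k)).prod (G i)) :=
    (hmean i).comp_snd _
  have hint i : ∫ z : ℝ × ℝ, z.1 + z.2 ∂(expMeasure (∑ k, lam k)).prod (G i) =
      1 / (∑ k, lam k) + ∫ s, s ∂G i := by
    rw [integral_add (hfst i) (hsnd i), integral_fun_fst (f := fun a : ℝ => a),
      integral_fun_snd (f := fun a : ℝ => a), integral_id_expMeasure hsum, probReal_univ,
      probReal_univ, one_smul, one_smul]
  have hlim : ∑ i, lam i / (∑ k, lam k) *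
      ∫ z : ℝ × ℝ, z.1 + z.2 ∂(expMeasure (∑ k, lam k)).prod (G i) =
      (1 + ∑ i, lam i * ∫ s, s ∂G i) / ∑ k, lam k := by
    simp only [hint, mul_add, Finset.sum_add_distrib, ← Finset.sum_mul, ← Finset.sum_div,
      add_div, div_mul_eq_mul_div, mul_one_div_cancel hsum.ne']
  rw [← hlim]
  exact ae_tendsto_birkhoffAverage_comp_firstPacket (f := fun z => z.2.1 + z.2.2) hlam hG
    (by fun_prop) fun i => (hfst i).add (hsnd i)

lemma ae_tendsto_birkhoffAverage_ite_firstClass [DecidableEq ι] (hlam : ∀ i, 0 < lam i)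
    (hG : ∀ i, ∀ᵐ s ∂G i, 0 ≤ s) {g : ℝ → ℝ} (hg : Measurable g) {i : ι}
    (hint : Integrable g (G i)) :
    ∀ᵐ W ∂inputLaw lam G, Tendsto (birkhoffAverage ℝ Input.next
        (fun W => if W.firstClass = i then g W.firstPacket.2.2 else 0) · W) atTop
      (𝓝 (lam i / (∑ k, lam k) * ∫ s, g s ∂G i)) := by
  have := isProbabilityMeasure_expMeasure
    (Finset.sum_pos (fun k _ => hlam k) (Finset.univ_nonempty (α := ι)))
  have hlim : ∑ j, lam j / (∑ k, lam k) *
      ∫ z : ℝ × ℝ, (if j = i then g z.2 else 0) ∂(expMeasure (∑ k, lam k)).prod (G j) =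
      lam i / (∑ k, lam k) * ∫ s, g s ∂G i := by
    rw [Finset.sum_eq_single_of_mem i (Finset.mem_univ i) fun j _ hj => by simp [hj]]
    simp only [if_true, integral_fun_snd (f := g), probReal_univ, one_smul]
  rw [← hlim]
  refine ae_tendsto_birkhoffAverage_comp_firstPacket
    (f := fun z => if z.1 = i then g z.2.2 else 0) hlam hG ?_ fun j => ?_
  · exact Measurable.ite (measurable_fst (measurableSet_singleton i)) (by fun_prop)
      measurable_const
  · rcases eq_or_ne j i with rfl | hj
    · simpa only [if_true] using hint.comp_snd (expMeasure (∑ k, lam k))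
    · simp only [hj, if_false, integrable_const]

end Regeneration

end Laws

section Queue

variable {N : ℕ} {T S : Fin N → ℕ → ℝ}

/-- A realization of the system that excludes simultaneous events (of two arrivals, or of an arrival
and the end of the service that a packet would receive on admission) and in which finitely many
packets arrive in finite time. -/
structure IsRegular (T S : Fin N → ℕ → ℝ) : Prop where
  arrival_pos : ∀ n i, 0 < T n i
  strictMono : ∀ n, StrictMono (T n)
  service_nonneg : ∀ n i, 0 ≤ S n i
  finite_le : ∀ t, {q : Fin N × ℕ | T q.1 q.2 ≤ t}.Finite
  injective : Function.Injective fun q : Fin N × ℕ => T q.1 q.2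
  departure_ne : ∀ p q : Fin N × ℕ, p ≠ q → T q.1 q.2 + S q.1 q.2 ≠ T p.1 p.2

lemma wellFounded_arrival_lt (hfin : ∀ t, {q : Fin N × ℕ | T q.1 q.2 ≤ t}.Finite) :
    WellFounded fun q p : Fin N × ℕ => T q.1 q.2 < T p.1 p.2 := by
  rw [WellFounded.wellFounded_iff_has_min]
  rintro s ⟨a, ha⟩
  obtain ⟨m, hm, hmin⟩ := Set.exists_min_image (s ∩ {q | T q.1 q.2 ≤ T a.1 a.2})
    (fun q => T q.1 q.2) ((hfin _).inter_of_right s) ⟨a, ha, le_refl (T a.1 a.2)⟩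
  exact ⟨m, hm.1, fun q hq hlt => (hmin q ⟨hq, hlt.le.trans hm.2⟩).not_gt hlt⟩

lemma IsAdmitted.unique (hfin : ∀ t, {q : Fin N × ℕ | T q.1 q.2 ≤ t}.Finite)
    {A B : Set (Fin N × ℕ)} (hA : IsAdmitted T S A) (hB : IsAdmitted T S B) : A = B := by
  ext p
  induction p using (wellFounded_arrival_lt hfin).induction with
  | _ p ih =>
    rw [hA p, hB p]
    exact ⟨fun h q hq hlt => h q ((ih q hlt).2 hq) hlt,
      fun h q hq hlt => h q ((ih q hlt).1 hq) hlt⟩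

section Peak

variable {Adm : Set (Fin N × ℕ)} {n : Fin N} {a₀ : ℝ}

lemma receptionTime_lt_arrival_nth_succ (hreg : IsRegular T S) (hadm : IsAdmitted T S Adm)
    (hinf : {i | (n, i) ∈ Adm}.Infinite) (k : ℕ) :
    receptionTime T S Adm n k < T n (Nat.nth (fun i => (n, i) ∈ Adm) (k + 1)) := by
  have hlt := Nat.nth_strictMono hinf k.lt_succ_self
  refine lt_of_le_of_ne ((hadm (n, _)).1 (Nat.nth_mem_of_infinite hinf (k + 1)) (n, _)
    (Nat.nth_mem_of_infinite hinf k) (hreg.strictMono n hlt)) ?_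
  exact hreg.departure_ne (n, _) (n, _) fun he => hlt.ne' (congrArg Prod.snd he)

lemma strictMono_receptionTime (hreg : IsRegular T S) (hadm : IsAdmitted T S Adm)
    (hinf : {i | (n, i) ∈ Adm}.Infinite) : StrictMono (receptionTime T S Adm n) :=
  strictMono_nat_of_lt_succ fun k =>
    (receptionTime_lt_arrival_nth_succ hreg hadm hinf k).trans_le
      (le_add_of_nonneg_right (hreg.service_nonneg n _))

lemma exists_nth_eq_of_mem (hinf : {i | (n, i) ∈ Adm}.Infinite) {i : ℕ} (hi : (n, i) ∈ Adm) :
    ∃ k, Nat.nth (fun i => (n, i) ∈ Adm) k = i := by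
  rwa [← Set.mem_range, Nat.range_nth_of_infinite hinf]

lemma peakAge_of_lastGeneration {u g : ℝ} {k : ℕ} (hu : u < receptionTime T S Adm n k)
    (hg : ∀ t, u ≤ t → t < receptionTime T S Adm n k → lastGeneration T S Adm a₀ n t = g) :
    peakAge T S Adm a₀ n k = receptionTime T S Adm n k - g := by
  refine leftLim_eq_of_tendsto ?_
  have hlim : Tendsto (fun t : ℝ => t - g) (𝓝[<] (receptionTime T S Adm n k))
      (𝓝 (receptionTime T S Adm n k - g)) :=
    ((continuous_id.sub continuous_const).tendsto _).mono_left nhdsWithin_le_nhds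
  refine hlim.congr' ?_
  filter_upwards [Ioo_mem_nhdsLT hu] with t ht
  rw [age, hg t ht.1.le ht.2]

lemma peakAge_zero (hreg : IsRegular T S) (hadm : IsAdmitted T S Adm)
    (hinf : {i | (n, i) ∈ Adm}.Infinite) (a₀ : ℝ) :
    peakAge T S Adm a₀ n 0 = receptionTime T S Adm n 0 + a₀ := by
  rw [peakAge_of_lastGeneration (sub_one_lt _) (g := -a₀), sub_neg_eq_add]
  intro t _ ht
  have hnone : {u | ∃ i, (n, i) ∈ Adm ∧ T n i + S n i ≤ t ∧ u = T n i} = ∅ := by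
    rw [Set.eq_empty_iff_forall_notMem]
    rintro _ ⟨i, hi, hle, -⟩
    obtain ⟨k, rfl⟩ := exists_nth_eq_of_mem hinf hi
    exact ((strictMono_receptionTime hreg hadm hinf).monotone k.zero_le).not_gt (hle.trans_lt ht)
  rw [lastGeneration, hnone, insert_empty_eq, csSup_singleton]

lemma peakAge_succ (hreg : IsRegular T S) (hadm : IsAdmitted T S Adm)
    (hinf : {i | (n, i) ∈ Adm}.Infinite) (ha₀ : 0 ≤ a₀) (k : ℕ) :
    peakAge T S Adm a₀ n (k + 1) =
      receptionTime T S Adm n (k + 1) - T n (Nat.nth (fun i => (n, i) ∈ Adm) k) := by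
  have hmono := strictMono_receptionTime hreg hadm hinf
  refine peakAge_of_lastGeneration (hmono k.lt_succ_self) fun t hkt ht => ?_
  refine IsGreatest.csSup_eq ⟨Or.inr ⟨_, Nat.nth_mem_of_infinite hinf k, hkt, rfl⟩, ?_⟩
  rintro _ (rfl | ⟨i, hi, hle, rfl⟩)
  · linarith [hreg.arrival_pos n (Nat.nth (fun i => (n, i) ∈ Adm) k)]
  · obtain ⟨j, rfl⟩ := exists_nth_eq_of_mem hinf hi
    have hj : j < k + 1 := hmono.lt_iff_lt.1 (hle.trans_lt ht)
    exact (hreg.strictMono n).monotone ((Nat.nth_strictMono hinf).monotone (Nat.le_of_lt_succ hj))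

lemma sum_peakAge (hreg : IsRegular T S) (hadm : IsAdmitted T S Adm)
    (hinf : {i | (n, i) ∈ Adm}.Infinite) (ha₀ : 0 ≤ a₀) (K : ℕ) :
    ∑ k ∈ Finset.range (K + 1), peakAge T S Adm a₀ n k =
      receptionTime T S Adm n K +
        ∑ k ∈ Finset.range K, S n (Nat.nth (fun i => (n, i) ∈ Adm) k) + a₀ := by
  induction K with
  | zero => simp [peakAge_zero hreg hadm hinf]
  | succ K ih =>
    rw [Finset.sum_range_succ, ih, peakAge_succ hreg hadm hinf ha₀, Finset.sum_range_succ,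
      receptionTime.eq_1 T S Adm n K]
    ring

end Peak

/-- The packets `p 0, p 1, …` are those served one after the other, where `R m` is the departure
time of the `m`-th of them (counted from `1`) and `R 0 = 0`: each `p m` is the first packet to
arrive after `R m`. -/
structure IsAdmissionSeq (T S : Fin N → ℕ → ℝ) (p : ℕ → Fin N × ℕ) (R : ℕ → ℝ) : Prop where
  zero : R 0 = 0
  lt_arrival : ∀ m, R m < T (p m).1 (p m).2
  arrival_le : ∀ m (q : Fin N × ℕ), R m < T q.1 q.2 → T (p m).1 (p m).2 ≤ T q.1 q.2
  succ : ∀ m, R (m + 1) = T (p m).1 (p m).2 + S (p m).1 (p m).2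

namespace IsAdmissionSeq

variable {p : ℕ → Fin N × ℕ} {R : ℕ → ℝ}

lemma arrival_le_succ (h : IsAdmissionSeq T S p R) (hreg : IsRegular T S) (m : ℕ) :
    T (p m).1 (p m).2 ≤ R (m + 1) :=
  h.succ m ▸ le_add_of_nonneg_right (hreg.service_nonneg _ _)

lemma monotone (h : IsAdmissionSeq T S p R) (hreg : IsRegular T S) : Monotone R :=
  monotone_nat_of_le_succ fun m => (h.lt_arrival m).le.trans (h.arrival_le_succ hreg m)

lemma departure_lt_arrival (h : IsAdmissionSeq T S p R) (hreg : IsRegular T S) {l m : ℕ}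
    (hlm : l < m) : T (p l).1 (p l).2 + S (p l).1 (p l).2 < T (p m).1 (p m).2 :=
  h.succ l ▸ (h.monotone hreg hlm).trans_lt (h.lt_arrival m)

lemma strictMono_arrival (h : IsAdmissionSeq T S p R) (hreg : IsRegular T S) :
    StrictMono fun m => T (p m).1 (p m).2 := fun _ _ hlm =>
  (le_add_of_nonneg_right (hreg.service_nonneg _ _)).trans_lt (h.departure_lt_arrival hreg hlm)

lemma injective (h : IsAdmissionSeq T S p R) (hreg : IsRegular T S) : Function.Injective p :=
  Function.Injective.of_comp (f := fun q : Fin N × ℕ => T q.1 q.2)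
    (h.strictMono_arrival hreg).injective

lemma exists_le (h : IsAdmissionSeq T S p R) (hreg : IsRegular T S) (t : ℝ) : ∃ m, t ≤ R m := by
  by_contra! hlt
  refine Set.infinite_range_of_injective (h.injective hreg) ((hreg.finite_le t).subset ?_)
  rintro _ ⟨m, rfl⟩
  exact (h.arrival_le_succ hreg m).trans (hlt (m + 1)).le

lemma eq_or_busy (h : IsAdmissionSeq T S p R) (hreg : IsRegular T S) (q : Fin N × ℕ) :
    ∃ m, q = p m ∨ (T (p m).1 (p m).2 < T q.1 q.2 ∧
      T q.1 q.2 < T (p m).1 (p m).2 + S (p m).1 (p m).2) := by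
  classical
  have hex := h.exists_le hreg (T q.1 q.2)
  obtain ⟨m, hm⟩ : ∃ m, Nat.find hex = m + 1 := by
    refine Nat.exists_eq_succ_of_ne_zero fun hzero => (hreg.arrival_pos q.1 q.2).not_ge ?_
    simpa only [hzero, h.zero] using Nat.find_spec hex
  have hle : T q.1 q.2 ≤ R (m + 1) := hm ▸ Nat.find_spec hex
  have hlt : R m < T q.1 q.2 := not_le.1 (Nat.find_min hex (by omega))
  refine ⟨m, or_iff_not_imp_left.2 fun hq => ⟨?_, ?_⟩⟩
  · exact lt_of_le_of_ne (h.arrival_le m q hlt) fun he => hq (hreg.injective he).symm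
  · exact lt_of_le_of_ne (h.succ m ▸ hle) (hreg.departure_ne q (p m) hq).symm

lemma isAdmitted (h : IsAdmissionSeq T S p R) (hreg : IsRegular T S) :
    IsAdmitted T S (Set.range p) := by
  refine fun q => ⟨?_, fun hq => ?_⟩
  · rintro ⟨m, rfl⟩ _ ⟨l, rfl⟩ hlt
    exact (h.departure_lt_arrival hreg ((h.strictMono_arrival hreg).lt_iff_lt.1 hlt)).le
  · obtain ⟨m, hm | ⟨harr, hdep⟩⟩ := h.eq_or_busy hreg q
    · exact ⟨m, hm.symm⟩
    · exact absurd (hq (p m) ⟨m, rfl⟩ harr) hdep.not_ge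

variable {n : Fin N}

lemma infinite_class (h : IsAdmissionSeq T S p R) (hreg : IsRegular T S)
    (hinf : {m | (p m).1 = n}.Infinite) : {i | (n, i) ∈ Set.range p}.Infinite := by
  have hinj : Set.InjOn (fun m => (p m).2) {m | (p m).1 = n} := fun l hl m hm hlm =>
    h.injective hreg (Prod.ext (Eq.trans hl (Eq.symm hm)) hlm)
  refine (hinf.image hinj).mono ?_
  rintro _ ⟨m, hm, rfl⟩
  exact ⟨m, Prod.ext hm rfl⟩

lemma apply_nth_eq (h : IsAdmissionSeq T S p R) (hreg : IsRegular T S)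
    (hinf : {m | (p m).1 = n}.Infinite) (k : ℕ) :
    p (Nat.nth (fun m => (p m).1 = n) k) = (n, Nat.nth (fun i => (n, i) ∈ Set.range p) k) := by
  have hinf' := h.infinite_class hreg hinf
  have hclass k : (p (Nat.nth (fun m => (p m).1 = n) k)).1 = n := Nat.nth_mem_of_infinite hinf k
  have hmono : StrictMono fun k => (p (Nat.nth (fun m => (p m).1 = n) k)).2 := fun j k hjk => by
    have hlt := h.strictMono_arrival hreg (Nat.nth_strictMono hinf hjk)
    simp only [hclass] at hlt
    exact (hreg.strictMono n).lt_iff_lt.1 hlt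
  have hrange : Set.range (fun k => (p (Nat.nth (fun m => (p m).1 = n) k)).2) =
      Set.range (Nat.nth fun i => (n, i) ∈ Set.range p) := by
    rw [Nat.range_nth_of_infinite hinf']
    ext i
    refine ⟨fun ⟨k, hk⟩ => ⟨_, Prod.ext (hclass k) hk⟩, fun ⟨m, hm⟩ => ?_⟩
    obtain ⟨k, rfl⟩ : m ∈ Set.range (Nat.nth fun m => (p m).1 = n) := by
      rw [Nat.range_nth_of_infinite hinf]
      exact congrArg Prod.fst hm
    exact ⟨k, congrArg Prod.snd hm⟩
  exact Prod.ext (hclass k) (congrFun ((hmono.range_inj (Nat.nth_strictMono hinf')).1 hrange) k)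

variable {a₀ : ℝ}

lemma sum_peakAge (h : IsAdmissionSeq T S p R) (hreg : IsRegular T S)
    (hinf : {m | (p m).1 = n}.Infinite) (ha₀ : 0 ≤ a₀) (K : ℕ) :
    ∑ k ∈ Finset.range (K + 1), peakAge T S (Set.range p) a₀ n k =
      R (Nat.nth (fun m => (p m).1 = n) K + 1) +
        (∑ m ∈ Finset.range (Nat.nth (fun m => (p m).1 = n) K),
          if (p m).1 = n then S (p m).1 (p m).2 else 0) + a₀ := by
  rw [MG11.sum_peakAge hreg (h.isAdmitted hreg) (h.infinite_class hreg hinf) ha₀, h.succ,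
    sum_range_nth_ite hinf fun m => S (p m).1 (p m).2]
  simp only [h.apply_nth_eq hreg hinf]
  rfl

lemma hasPAoI (h : IsAdmissionSeq T S p R) (hreg : IsRegular T S) (ha₀ : 0 ≤ a₀) {c r v : ℝ}
    (hc : c ≠ 0)
    (hcount : Tendsto (fun m : ℕ => (Nat.count (fun l => (p l).1 = n) m : ℝ) / m) atTop (𝓝 c))
    (hR : Tendsto (fun m : ℕ => R m / m) atTop (𝓝 r))
    (hS : Tendsto (fun m : ℕ => (∑ l ∈ Finset.range m,
      if (p l).1 = n then S (p l).1 (p l).2 else 0) / m) atTop (𝓝 v)) :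
    HasPAoI T S (Set.range p) a₀ n ((r + v) / c) := by
  have hinf := infinite_of_tendsto_count_div hc hcount
  refine ⟨h.infinite_class hreg hinf, ?_⟩
  have hlim : Tendsto (fun m : ℕ => (R (m + 1) + (∑ l ∈ Finset.range m,
      if (p l).1 = n then S (p l).1 (p l).2 else 0) + a₀) / m) atTop (𝓝 (r + v)) := by
    simpa only [← add_div, add_zero] using ((tendsto_succ_div_iff.2 hR).add hS).add
      (tendsto_const_div_atTop_nhds_zero_nat a₀)
  refine (tendsto_succ_div_iff.1 ?_).congr fun K => (one_div_mul_eq_div _ _).symm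
  exact (tendsto_comp_nth_div hc hcount hlim).congr fun K =>
    congrArg (· / (K : ℝ)) (h.sum_peakAge hreg hinf ha₀ K).symm

end IsAdmissionSeq

end Queue

namespace Input

open MarkedStream

section Fin

variable {N : ℕ} {W : Input (Fin N)}

/-- The arrival times and the service times of the input are a regular realization. -/
abbrev IsRegular (W : Input (Fin N)) : Prop :=
  MG11.IsRegular (fun n => (W n).arrival) fun n i => (W n i).2

lemma isRegular_of (hpos : ∀ n i, 0 < (W n i).1) (hnonneg : ∀ n i, 0 ≤ (W n i).2)
    (hunb : ∀ n, (W n).Unbounded)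
    (harrival : ∀ n k, n ≠ k → ∀ i j, (W n).arrival i ≠ (W k).arrival j)
    (hdeparture : ∀ n k, n ≠ k → ∀ i j, (W n).arrival i ≠ (W k).arrival j + (W k j).2)
    (hself : ∀ n i j, j < i → (W n).arrival i ≠ (W n).arrival j + (W n j).2) : IsRegular W where
  arrival_pos n i := (hpos n 0).trans_le
    (arrival_zero (W n) ▸ (strictMono_arrival (hpos n)).monotone i.zero_le)
  strictMono n := strictMono_arrival (hpos n)
  service_nonneg := hnonneg
  finite_le t := by
    choose j hj using fun n => hunb n t
    refine (Set.finite_iUnion fun n => (Set.finite_Iio (j n)).image (Prod.mk n)).subset ?_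
    rintro ⟨n, i⟩ (hi : (W n).arrival i ≤ t)
    exact Set.mem_iUnion.2
      ⟨n, i, (strictMono_arrival (hpos n)).lt_iff_lt.1 (hi.trans_lt (hj n)), rfl⟩
  injective := by
    rintro ⟨n, i⟩ ⟨k, j⟩ he
    obtain rfl : n = k := by
      by_contra hnk
      exact harrival n k hnk i j he
    exact congrArg (Prod.mk n) ((strictMono_arrival (hpos n)).injective he)
  departure_ne := by
    rintro ⟨n, i⟩ ⟨k, j⟩ hpq
    rcases ne_or_eq n k with hnk | rfl
    · exact (hdeparture n k hnk i j).symm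
    rcases lt_trichotomy i j with hij | rfl | hji
    · exact ((strictMono_arrival (hpos n) hij).trans_le
        (le_add_of_nonneg_right (hnonneg n j))).ne'
    · exact absurd rfl hpq
    · exact (hself n i j hji).symm

lemma IsRegular.unbounded (h : IsRegular W) (n : Fin N) : (W n).Unbounded := by
  intro r
  by_contra! hle
  refine Set.infinite_range_of_injective (Prod.mk_right_injective n)
    ((h.finite_le r).subset ?_)
  rintro _ ⟨i, rfl⟩
  exact hle i

variable [Nonempty (Fin N)]

/-- The time at which the server becomes idle for the `m`-th time. -/
def idleTime (W : Input (Fin N)) (m : ℕ) : ℝ := birkhoffSum next firstDeparture m W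

/-- The label of the `m`-th admitted packet. -/
def admittedPacket (W : Input (Fin N)) (m : ℕ) : Fin N × ℕ :=
  (firstClass (next^[m] W), firstAfter (idleTime W m) (W (firstClass (next^[m] W))))

lemma IsRegular.isFirst_firstClass_shift (h : IsRegular W) (r : ℝ) :
    IsFirst (fun k => shift r (W k)) (firstClass fun k => shift r (W k)) := by
  obtain ⟨n, hn⟩ := Finite.exists_min fun k => (shift r (W k) 0).1
  have hfirst : IsFirst (fun k => shift r (W k)) n := by
    refine fun k hk => lt_of_le_of_ne (hn k) fun he => hk ?_
    simp only [shift_apply_zero, sub_left_inj] at he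
    exact (congrArg Prod.fst (h.injective (a₁ := (n, _)) (a₂ := (k, _)) he)).symm
  rwa [hfirst.firstClass_eq]

lemma IsRegular.firstDeparture_shift_nonneg (h : IsRegular W) (r : ℝ) :
    0 ≤ firstDeparture fun k => shift r (W k) := by
  simp only [firstDeparture, firstPacket, shift_apply_zero]
  set n := firstClass fun k => shift r (W k)
  exact add_nonneg (sub_nonneg.2 ((h.unbounded n).lt_arrival_firstAfter r).le)
    (h.service_nonneg n _)

lemma IsRegular.iterate_next (h : IsRegular W) (m : ℕ) :
    next^[m] W = fun k => shift (idleTime W m) (W k) := by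
  induction m with
  | zero =>
    funext k
    have hfirst : firstAfter 0 (W k) = 0 := firstAfter_eq_of (h.arrival_pos k 0) (by simp)
    apply ext_arrival <;> intro i <;> simp [idleTime, arrival_shift, shift_snd, hfirst]
  | succ m ih =>
    rw [Function.iterate_succ_apply', idleTime, birkhoffSum_succ, ← idleTime, ih]
    exact funext fun k => (h.unbounded k).shift_shift (h.firstDeparture_shift_nonneg _)

lemma IsRegular.iterate_next_apply_zero (h : IsRegular W) (m : ℕ) (k : Fin N) :
    next^[m] W k 0 = ((W k).arrival (firstAfter (idleTime W m) (W k)) - idleTime W m,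
      (W k (firstAfter (idleTime W m) (W k))).2) :=
  congrFun (congrFun (h.iterate_next m) k) 0

lemma IsRegular.firstPacket_iterate_next (h : IsRegular W) (m : ℕ) :
    firstPacket (next^[m] W) = ((admittedPacket W m).1,
      ((W (admittedPacket W m).1).arrival (admittedPacket W m).2 - idleTime W m,
        (W (admittedPacket W m).1 (admittedPacket W m).2).2)) :=
  Prod.ext rfl (h.iterate_next_apply_zero m _)

lemma IsRegular.isAdmissionSeq (h : IsRegular W) :
    IsAdmissionSeq (fun n => (W n).arrival) (fun n i => (W n i).2) (admittedPacket W)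
      (idleTime W) where
  zero := birkhoffSum_zero _ _ _
  lt_arrival m := (h.unbounded _).lt_arrival_firstAfter _
  arrival_le m q hq := by
    have hfirst := h.isFirst_firstClass_shift (idleTime W m)
    rw [← h.iterate_next m] at hfirst
    have hle : (W q.1).arrival (firstAfter (idleTime W m) (W q.1)) ≤ (W q.1).arrival q.2 :=
      (h.strictMono q.1).monotone (Nat.sInf_le hq)
    refine le_trans ?_ hle
    rcases eq_or_ne q.1 (firstClass (next^[m] W)) with hq | hq
    · rw [hq]; rfl
    · have hlt := hfirst q.1 hq
      rw [h.iterate_next_apply_zero, h.iterate_next_apply_zero] at hlt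
      exact ((sub_lt_sub_iff_right _).1 hlt).le
  succ m := by
    rw [idleTime, birkhoffSum_succ, ← idleTime, firstDeparture, h.firstPacket_iterate_next]
    ring

lemma IsRegular.hasPAoI (h : IsRegular W) {n : Fin N} {a₀ : ℝ} (ha₀ : 0 ≤ a₀) {c r v : ℝ}
    (hc : c ≠ 0)
    (hclass : Tendsto (birkhoffAverage ℝ next (fun V => if V.firstClass = n then 1 else 0) · W)
      atTop (𝓝 c))
    (hidle : Tendsto (birkhoffAverage ℝ next firstDeparture · W) atTop (𝓝 r))
    (hservice : Tendsto (birkhoffAverage ℝ next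
      (fun V => if V.firstClass = n then V.firstPacket.2.2 else 0) · W) atTop (𝓝 v)) :
    HasPAoI (fun n => (W n).arrival) (fun n i => (W n i).2) (Set.range (admittedPacket W)) a₀ n
      ((r + v) / c) := by
  refine h.isAdmissionSeq.hasPAoI h ha₀ hc (hclass.congr fun m => ?_) (hidle.congr fun m => ?_)
    (hservice.congr fun m => ?_)
  · rw [birkhoffAverage, smul_eq_mul, inv_mul_eq_div, birkhoffSum, Finset.sum_boole,
      Nat.count_eq_card_filter_range]
    rfl
  · rw [birkhoffAverage, smul_eq_mul, inv_mul_eq_div, idleTime]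
  · simp only [birkhoffAverage, smul_eq_mul, inv_mul_eq_div, birkhoffSum,
      h.firstPacket_iterate_next]
    rfl

end Fin

end Input

namespace MarkedStream

lemma ae_arrival_ne {E : Type*} [MeasurableSpace E] {r : ℝ} (hr : 0 < r) {G : Measure E}
    [IsProbabilityMeasure G] (i : ℕ) (c : ℝ) : ∀ᵐ w ∂poissonLaw r G, w.arrival i ≠ c := by
  have := isProbabilityMeasure_expMeasure hr
  induction i generalizing c with
  | zero =>
    have hfst : ∀ᵐ z ∂(expMeasure r).prod G, z.1 ≠ c :=
      Measure.quasiMeasurePreserving_fst.ae (compl_mem_ae_iff.2 (measure_singleton c))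
    filter_upwards [ae_iidLaw_forall hfst] with w hw
    exact arrival_zero w ▸ hw 0
  | succ i ih =>
    refine ae_iidLaw_of_prepend (measurableSet_eq_fun (measurable_arrival _)
      measurable_const).compl (ae_of_all _ fun z => ?_)
    filter_upwards [ih (c - z.1)] with w hw
    rw [arrival_prepend_succ]
    exact fun he => hw (eq_sub_of_add_eq' he)

lemma measurable_arrival_add_mark (i : ℕ) :
    Measurable fun w : MarkedStream ℝ => w.arrival i + (w i).2 :=
  (measurable_arrival i).add (measurable_pi_apply i).snd

lemma ae_arrival_ne_arrival_add_mark {r : ℝ} (hr : 0 < r) {G : Measure ℝ} [IsProbabilityMeasure G]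
    {i j : ℕ} (hji : j < i) : ∀ᵐ w ∂poissonLaw r G, w.arrival i ≠ w.arrival j + (w j).2 := by
  have := isProbabilityMeasure_expMeasure hr
  induction i generalizing j with
  | zero => exact absurd hji j.not_lt_zero
  | succ i ih =>
    refine ae_iidLaw_of_prepend (measurableSet_eq_fun (measurable_arrival _)
      (measurable_arrival_add_mark j)).compl (ae_of_all _ fun z => ?_)
    cases j with
    | zero =>
      filter_upwards [ae_arrival_ne hr i z.2] with w hw
      rw [arrival_prepend_succ, arrival_prepend_zero]
      exact fun he => hw (add_left_cancel he)
    | succ j =>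
      filter_upwards [ih (Nat.succ_lt_succ_iff.1 hji)] with w hw
      rw [arrival_prepend_succ, arrival_prepend_succ, add_assoc]
      exact fun he => hw (add_left_cancel he)

end MarkedStream

namespace Input

open MarkedStream

variable {N : ℕ} {lam : Fin N → ℝ} {G : Fin N → Measure ℝ} [∀ n, IsProbabilityMeasure (G n)]

lemma ae_isRegular (hlam : ∀ n, 0 < lam n) (hG : ∀ n, ∀ᵐ s ∂G n, 0 ≤ s) :
    ∀ᵐ W ∂inputLaw lam G, W.IsRegular := by
  have hprob n := isProbabilityMeasure_poissonLaw (G := G n) (hlam n)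
  have hstream {p : Fin N → MarkedStream ℝ → Prop}
      (h : ∀ n, ∀ᵐ w ∂poissonLaw (lam n) (G n), p n w) : ∀ᵐ W ∂inputLaw lam G, ∀ n, p n (W n) :=
    ae_all_iff.2 fun n => (Measure.quasiMeasurePreserving_eval
      (μ := fun n => poissonLaw (lam n) (G n)) n).ae (h n)
  have hne {f : ℕ → MarkedStream ℝ → ℝ} (hf : ∀ j, Measurable (f j)) : ∀ᵐ W ∂inputLaw lam G,
      ∀ n k, n ≠ k → ∀ i j, (W n).arrival i ≠ f j (W k) := by
    simp only [ae_all_iff]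
    exact fun n k hnk i j => ae_pi_eval_ne (μ := fun n => poissonLaw (lam n) (G n)) hnk
      (measurable_arrival i) (hf j) (ae_arrival_ne (hlam n) i)
  have hself n : ∀ᵐ w ∂poissonLaw (lam n) (G n),
      ∀ i j, j < i → w.arrival i ≠ w.arrival j + (w j).2 := by
    simp only [ae_all_iff]
    exact fun i j hji => ae_arrival_ne_arrival_add_mark (hlam n) hji
  filter_upwards [hstream fun n => ae_forall_pos_and_nonneg_poissonLaw (hlam n) (hG n),
    hstream fun n => ae_unbounded_poissonLaw (hlam n), hstream hself, hne measurable_arrival,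
    hne measurable_arrival_add_mark] with W hsign hunb hself harrival hdeparture
  exact isRegular_of (fun n i => (hsign n i).1) (fun n i => (hsign n i).2) hunb harrival
    hdeparture hself

variable [Nonempty (Fin N)]

lemma ae_hasPAoI (hlam : ∀ n, 0 < lam n) (hG : ∀ n, ∀ᵐ s ∂G n, 0 ≤ s)
    (hmean : ∀ n, Integrable (fun s => s) (G n)) {a₀ : Fin N → ℝ} (ha₀ : ∀ n, 0 ≤ a₀ n) :
    ∀ᵐ W ∂inputLaw lam G, ∀ n,
      HasPAoI (fun k => (W k).arrival) (fun k i => (W k i).2) (Set.range (admittedPacket W))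
        (a₀ n) n (∫ s, s ∂G n + 1 / lam n + (∑ k, lam k * ∫ s, s ∂G k) / lam n) := by
  have hsum : 0 < ∑ k, lam k := Finset.sum_pos (fun k _ => hlam k) Finset.univ_nonempty
  rw [ae_all_iff]
  intro n
  filter_upwards [ae_isRegular hlam hG, ae_tendsto_birkhoffAverage_firstDeparture hlam hG hmean,
    ae_tendsto_birkhoffAverage_ite_firstClass hlam hG (measurable_const (a := (1 : ℝ)))
      (i := n) (integrable_const 1),
    ae_tendsto_birkhoffAverage_ite_firstClass hlam hG measurable_id (hmean n)]
    with W hreg hidle hclass hservice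
  rw [integral_const, probReal_univ, one_smul, mul_one] at hclass
  convert hreg.hasPAoI (ha₀ n) (div_pos (hlam n) hsum).ne' hclass hidle hservice using 1
  have := hlam n
  field_simp
  simp only [id]
  ring

end Input

section Transfer

open MarkedStream

variable {Ω α : Type*} [MeasurableSpace Ω] [MeasurableSpace α] {P : Measure Ω}

lemma measurePreserving_curry_infinitePi {ι κ : Type*} (μ : ι × κ → Measure α)
    [∀ p, IsProbabilityMeasure (μ p)] :
    MeasurePreserving (MeasurableEquiv.curry ι κ α) (Measure.infinitePi μ)
      (Measure.infinitePi fun i => Measure.infinitePi fun j => μ (i, j)) :=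
  ⟨MeasurableEquiv.measurable _, Measure.infinitePi_map_curry fun i j => μ (i, j)⟩

lemma hasLaw_infinitePi_prod {κ : Type*} [Countable κ] {μ ν : κ → Measure α}
    [∀ p, IsProbabilityMeasure (μ p)] [∀ p, IsProbabilityMeasure (ν p)] {X Y : κ → Ω → α}
    (hX : ∀ p, HasLaw (X p) (μ p) P) (hY : ∀ p, HasLaw (Y p) (ν p) P)
    (hindep : iIndepFun (Sum.elim X Y) P) :
    HasLaw (fun ω p => (X p ω, Y p ω)) (Measure.infinitePi fun p => (μ p).prod (ν p)) P := by
  set e : κ × Bool ≃ κ ⊕ κ := (Equiv.prodComm κ Bool).trans (Equiv.boolProdEquivSum κ)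
  have hprob q : IsProbabilityMeasure (Sum.elim μ ν q) := by
    rcases q with p | p
    exacts [inferInstanceAs (IsProbabilityMeasure (μ p)),
      inferInstanceAs (IsProbabilityMeasure (ν p))]
  have hcoord q : HasLaw (Sum.elim X Y (e q)) (Sum.elim μ ν (e q)) P := by
    rcases e q with p | p
    exacts [hX p, hY p]
  have hlaw : HasLaw (fun ω q => Sum.elim X Y (e q) ω)
      (Measure.infinitePi fun q => Sum.elim μ ν (e q)) P :=
    (hindep.precomp e.injective).hasLaw_infinitePi hcoord
      (aemeasurable_pi_iff.2 fun q => (hcoord q).aemeasurable)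
  have hpair p : (Measure.infinitePi fun b => Sum.elim μ ν (e (p, b))).map
      (fun y => (y false, y true)) = (μ p).prod (ν p) :=
    Measure.infinitePi_map_eval_prod (by simp)
  have hpairs : MeasurePreserving (fun (u : κ → Bool → α) p => (u p false, u p true))
      (Measure.infinitePi fun p => Measure.infinitePi fun b => Sum.elim μ ν (e (p, b)))
      (Measure.infinitePi fun p => (μ p).prod (ν p)) := by
    refine ⟨by fun_prop, ?_⟩
    rw [Measure.infinitePi_map_pi (f := fun _ (y : Bool → α) => (y false, y true)) _
      fun _ => by fun_prop]
    simp only [hpair]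
  exact (hpairs.comp (measurePreserving_curry_infinitePi _)).comp_hasLaw hlaw

lemma hasLaw_inputLaw {ι : Type*} [Fintype ι] {lam : ι → ℝ} (hlam : ∀ i, 0 < lam i)
    {G : ι → Measure ℝ} [∀ i, IsProbabilityMeasure (G i)] {τ S : ι → ℕ → Ω → ℝ}
    (hτ : ∀ n i, HasLaw (τ n i) (expMeasure (lam n)) P) (hS : ∀ n i, HasLaw (S n i) (G n) P)
    (hindep : iIndepFun
      (Sum.elim (fun p : ι × ℕ => τ p.1 p.2) (fun p : ι × ℕ => S p.1 p.2)) P) :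
    HasLaw (fun ω n i => (τ n i ω, S n i ω)) (inputLaw lam G) P := by
  have hexp n := isProbabilityMeasure_expMeasure (hlam n)
  have hprob n := isProbabilityMeasure_poissonLaw (G := G n) (hlam n)
  have hpairs := hasLaw_infinitePi_prod (fun p : ι × ℕ => hτ p.1 p.2) (fun p => hS p.1 p.2) hindep
  have hcurry := measurePreserving_curry_infinitePi fun p : ι × ℕ =>
    (expMeasure (lam p.1)).prod (G p.1)
  rw [inputLaw, ← Measure.infinitePi_eq_pi]
  exact hcurry.comp_hasLaw hpairs

end Transfer

end

end MG11

theorem mainTheorem2 {Ω : Type*} [MeasurableSpace Ω] (μ : Measure Ω) [IsProbabilityMeasure μ]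
    (N : ℕ)
    -- arrival rates and service time distributions of the classes
    (lam : Fin N → ℝ) (hlam : ∀ n, 0 < lam n)
    (G : Fin N → Measure ℝ) (hG_nonneg : ∀ n, ∀ᵐ s ∂(G n), 0 ≤ s)
    (hG_mean : ∀ n, Integrable (fun s : ℝ => s) (G n))
    (x : Fin N → ℝ) (hx : ∀ n, x n = ∫ s, s ∂(G n))
    -- inter-arrival times and service times, all independent
    (τ S : Fin N → ℕ → Ω → ℝ)
    (hτ : ∀ n i, HasLaw (τ n i) (expMeasure (lam n)) μ)
    (hS : ∀ n i, HasLaw (S n i) (G n) μ)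
    (hindep : iIndepFun
      (Sum.elim (fun p : Fin N × ℕ => τ p.1 p.2) (fun p : Fin N × ℕ => S p.1 p.2)) μ)
    -- initial status ages
    (a₀ : Fin N → ℝ) (ha₀ : ∀ n, 0 ≤ a₀ n) :
    ∀ᵐ ω ∂μ,
      (∃! Adm : Set (Fin N × ℕ),
        MG11.IsAdmitted (fun n => MG11.arrivalTime (fun i => τ n i ω)) (fun n i => S n i ω) Adm) ∧
      ∀ Adm : Set (Fin N × ℕ),
        MG11.IsAdmitted (fun n => MG11.arrivalTime (fun i => τ n i ω)) (fun n i => S n i ω) Adm →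
        ∀ n : Fin N,
          MG11.HasPAoI (fun n => MG11.arrivalTime (fun i => τ n i ω)) (fun n i => S n i ω)
            Adm (a₀ n) n (x n + 1 / lam n + (∑ k, lam k * x k) / lam n) := by
  have hprob n : IsProbabilityMeasure (G n) := ((hS n 0).isProbabilityMeasure_iff).1 inferInstance
  have hlaw := MG11.hasLaw_inputLaw hlam hτ hS hindep
  rcases isEmpty_or_nonempty (Fin N) with hN | hN
  · exact ae_of_all _ fun ω => ⟨⟨∅, fun p => hN.elim p.1, fun A _ => Set.eq_empty_of_isEmpty A⟩,
      fun _ _ n => hN.elim n⟩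
  · have hinput := (MG11.Input.ae_isRegular hlam hG_nonneg).and
      (MG11.Input.ae_hasPAoI hlam hG_nonneg hG_mean ha₀)
    rw [← hlaw.map_eq] at hinput
    filter_upwards [ae_of_ae_map hlaw.aemeasurable hinput] with ω ⟨hreg, hpaoi⟩
    have hadm := hreg.isAdmissionSeq.isAdmitted hreg
    have hunique A hA := MG11.IsAdmitted.unique hreg.finite_le (A := A) hA hadm
    refine ⟨⟨_, hadm, hunique⟩, fun A hA n => ?_⟩
    simp only [hunique A hA, hx]
    exact hpaoi n
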